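/- Let $$F(x)=\sum_{i=1}^{n} w_i\,\mathcal N(\mu_i,\sigma_i^2,x),\qquad F'(x)=\sum_{j=1}^{k} w'_j\,\mathcal N(\mu'_j,\sigma_j'^2,x)$$ denote the densities of two univariate Gaussian mixtures ($n,k\ge 1$, nonnegative weights summing to $1$ in each mixture, positive variances), where $\mathcal N(\mu,\sigma^2,\cdot)$ is the density of the Gaussian with mean $\mu$ and variance $\sigma^2$, and let $M_r(F)=\int_{\mathbb R} x^r F(x)\,dx$ denote the $r$-th raw moment. For $\varepsilon>0$ the pair $F,F'$ is called $\varepsilon$-standard if $\sigma_i^2\le 1$ and $\sigma_j'^2\le 1$ for all $i,j$, and 1. $w_i,\,w'_j\in[\varepsilon,1]$ for all $i,j$; 2. $|\mu_i|,\,|\mu'_j|\le 1/\varepsilon$ for all $i,j$; 3. $|\mu_i-\mu_j|+|\sigma_i^2-\sigma_j^2|\ge\varepsilon$ and $|\mu'_i-\mu'_j|+|\sigma_i'^2-\sigma_j'^2|\ge\varepsilon$ for all $i\ne j$; 4. $\varepsilon\le \sum_{i=1}^n\bigl(|w_i-w'_{\pi(i)}|+|\mu_i-\mu'_{\pi(i)}|+|\sigma_i^2-\sigma_{\pi(i)}'^2|\bigr)$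 for every mapping $\pi:\{1,\dots,n\}\to\{1,\dots,k\}$. **Theorem.** There are absolute constants $c>0$ and $C\in\mathbb N$ such that for all $n,k\ge 1$, all $0<\varepsilon<c$ and every $\varepsilon$-standard pair $F,F'$ of mixtures of $n$ and $k$ Gaussians respectively, $$\max_{1\le r\le 2(n+k-1)}\bigl|M_r(F)-M_r(F')\bigr|\;\ge\;\varepsilon^{\,C\max(n,k)}.$$ -/

import Mathlib

open scoped NNReal

noncomputable section

/-- The parameters of a univariate mixture of `n` Gaussians. -/
structure GaussianMixture (n : ℕ) where
  weight : Fin n → ℝ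
  mean : Fin n → ℝ
  var : Fin n → ℝ≥0
  weight_nonneg : ∀ i, 0 ≤ weight i
  sum_weight : ∑ i, weight i = 1
  var_pos : ∀ i, 0 < var i

namespace GaussianMixture

/-- The density `F(x) = ∑ i, w i * N(μ i, σ² i, x)`. -/
def pdf {n : ℕ} (F : GaussianMixture n) (x : ℝ) : ℝ :=
  ∑ i, F.weight i * ProbabilityTheory.gaussianPDFReal (F.mean i) (F.var i) x

/-- The `r`-th raw moment `M_r(F) = E_{x ∼ F}[x ^ r]`. -/
def moment {n : ℕ} (F : GaussianMixture n) (r : ℕ) : ℝ :=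
  ∫ x : ℝ, x ^ r * F.pdf x

/-- Parameter distance `|μ i - μ' j| + |σ² i - σ'² j|` between two components. -/
def paramDist {n k : ℕ} (F : GaussianMixture n) (F' : GaussianMixture k)
    (i : Fin n) (j : Fin k) : ℝ :=
  |F.mean i - F'.mean j| + |(F.var i : ℝ) - (F'.var j : ℝ)|

/-- The pair `F, F'` is `ε`-standard. -/
structure IsStandard {n k : ℕ} (F : GaussianMixture n) (F' : GaussianMixture k) (ε : ℝ) :
    Prop where
  var_le : ∀ i, F.var i ≤ 1
  var_le' : ∀ j, F'.var j ≤ 1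
  weight_mem : ∀ i, F.weight i ∈ Set.Icc ε 1
  weight_mem' : ∀ j, F'.weight j ∈ Set.Icc ε 1
  mean_le : ∀ i, |F.mean i| ≤ 1 / ε
  mean_le' : ∀ j, |F'.mean j| ≤ 1 / ε
  separated : ∀ i₁ i₂, i₁ ≠ i₂ → ε ≤ F.paramDist F i₁ i₂
  separated' : ∀ j₁ j₂, j₁ ≠ j₂ → ε ≤ F'.paramDist F' j₁ j₂
  far : ∀ π : Fin n → Fin k,
    ε ≤ ∑ i, (|F.weight i - F'.weight (π i)| + F.paramDist F' i (π i))

end GaussianMixture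

end

/-! Let `Λ p` be the difference of the expectations of a polynomial `p` under `F` and `F'`. Then `Λ
p = ∑ a_j u(x_j, t_j)` over all `n + k` components, with signed weights `a_j`, means `x_j`,
variances `t_j`, and `u(·, t) = exp(t ∂²/2) p` the caloric extension of `p`. Fix a time `τ` and
write `p = exp(-τ ∂²/2) q`. Components with `t_j > τ` together contribute `∫ q f`, where `f` is the
combination of Gaussian densities of variances `t_j - τ`; the others contribute values of the
backward extension of `q`.

The heart is a `q` of degree at most `2(n + k - 1)` with `q f ≥ 0` for which the other contributions
vanish (`exists_sign_matching_polynomial`). Take `q = ± D P v`. Here `D` is split with the sign of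
`f` and has degree at most twice the number of later components minus two
(`exists_polynomial_sum_gaussianPDFReal`); `P` has double zeros at the components with `t_j = τ`;
and `v`, found by linear algebra, gives the backward extension a double root at each component with
`t_j < τ`. Forward heat flow destroys two real roots for each such double root
(`card_roots_add_two_mul_card_le`), and `D P` splits, so no real roots are left for `v`, which thus
has constant sign.

Now `Λ p = ∫ q f`. If `|f| ≥ 1` on a window, this is at least the integral of `|q|` there, while
small moment differences bound it above through Lagrange interpolation on grids filling the window
(`le_of_linearMap_heat_eq_integral`). To make `f` large, put `τ` slightly below the variance of a
component of `F`, which becomes a tall spike. The spike survives if no component of `F'` is close to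
it, or if the close one has a different weight; `far` ensures that one of these happens. -/

namespace Polynomial

/-! ### The heat operator on polynomials. -/

/-- Multiplication by `X` plus `s` times differentiation. -/
noncomputable def heatGen (s : ℝ) : Module.End ℝ ℝ[X] :=
  LinearMap.mulLeft ℝ X + s • derivative

/-- The heat operator `exp (s ∂² / 2)` on real polynomials, for every real `s`. -/
noncomputable def heat (s : ℝ) : ℝ[X] →ₗ[ℝ] ℝ[X] :=
  LinearMap.applyₗ (1 : ℝ[X]) ∘ₗ (aeval (heatGen s)).toLinearMap

/-- Conjugation by `exp(s ∂²/2)` turns multiplication by `X` into `X + s ∂`, and `1` is fixed; hence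
`q(X + s ∂) 1`. The formula makes sense for negative `s`, so the flow also runs backward. -/
theorem heat_apply (s : ℝ) (q : ℝ[X]) : heat s q = aeval (heatGen s) q 1 := rfl

theorem heat_C (s a : ℝ) : heat s (C a) = C a := by
  rw [heat_apply, aeval_C, Module.algebraMap_end_apply, smul_eq_C_mul, mul_one]

theorem heat_one (s : ℝ) : heat s 1 = 1 := by
  simpa using heat_C s 1

theorem heat_X_mul (s : ℝ) (q : ℝ[X]) :
    heat s (X * q) = X * heat s q + s • derivative (heat s q) := by
  simp [heat_apply, heatGen]

/-- For `s ≠ 0` the right side is `s exp(-(x - z)²/(2s))` times the derivative of `exp((x -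
z)²/(2s)) * heat s q`. This is what lets Rolle's theorem compare `q` with `(X - z) q` after the
flow. -/
theorem heat_X_sub_C_mul (s z : ℝ) (q : ℝ[X]) :
    heat s ((X - C z) * q) = (X - C z) * heat s q + s • derivative (heat s q) := by
  rw [sub_mul, map_sub, heat_X_mul, ← smul_eq_C_mul, map_smul, smul_eq_C_mul, smul_eq_C_mul]
  ring

/-- Induction on polynomials through constants, sums and multiplication by `X`. -/
theorem induction_C_add_X_mul {P : ℝ[X] → Prop} (hC : ∀ a, P (C a))
    (hadd : ∀ p q, P p → P q → P (p + q)) (hX : ∀ p, P p → P (X * p)) (q : ℝ[X]) : P q := by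
  induction q using Polynomial.induction_on with
  | C a => exact hC a
  | add p q hp hq => exact hadd p q hp hq
  | monomial n a h =>
    have := hX _ h
    rwa [show X * (C a * X ^ n) = C a * X ^ (n + 1) by ring] at this

theorem heat_derivative (s : ℝ) (q : ℝ[X]) :
    heat s (derivative q) = derivative (heat s q) := by
  induction q using induction_C_add_X_mul with
  | hC a => simp [heat_C]
  | hadd p q hp hq => simp [hp, hq]
  | hX p hp =>
    rw [derivative_mul, derivative_X, one_mul, map_add, heat_X_mul, heat_X_mul, hp]
    simp
    ring

theorem heat_heat (s t : ℝ) (q : ℝ[X]) : heat s (heat t q) = heat (s + t) q := by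
  induction q using induction_C_add_X_mul with
  | hC a => simp [heat_C]
  | hadd p q hp hq => simp [hp, hq]
  | hX p hp =>
    rw [heat_X_mul, heat_X_mul, map_add, heat_X_mul, map_smul, heat_derivative, hp, add_smul]
    ring

theorem heat_zero (q : ℝ[X]) : heat 0 q = q := by
  induction q using induction_C_add_X_mul with
  | hC a => simp [heat_C]
  | hadd p q hp hq => simp [hp, hq]
  | hX p hp => simp [heat_X_mul, hp]

theorem heat_ne_zero (s : ℝ) {q : ℝ[X]} (hq : q ≠ 0) : heat s q ≠ 0 := by
  intro h
  apply hq
  rw [← heat_zero q, ← neg_add_cancel s, ← heat_heat, h, map_zero]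

theorem natDegree_heat_X_pow_le (s : ℝ) (n : ℕ) : (heat s (X ^ n)).natDegree ≤ n := by
  induction n with
  | zero => simp [heat_one]
  | succ n ih =>
    rw [pow_succ', heat_X_mul]
    refine natDegree_add_le_of_degree_le ?_ ?_
    · exact natDegree_mul_le.trans (by rw [natDegree_X]; lia)
    · exact (natDegree_smul_le _ _).trans ((natDegree_derivative_le _).trans (by lia))

theorem natDegree_heat_le (s : ℝ) (q : ℝ[X]) : (heat s q).natDegree ≤ q.natDegree := by
  conv_lhs => rw [q.as_sum_range_C_mul_X_pow, map_sum]
  refine natDegree_sum_le_of_forall_le _ _ fun i hi => ?_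
  rw [← smul_eq_C_mul, map_smul]
  exact (natDegree_smul_le _ _).trans ((natDegree_heat_X_pow_le s i).trans (by
    simpa [Nat.lt_succ_iff] using hi))

theorem heat_X_pow_add_two (s : ℝ) (n : ℕ) :
    heat s (X ^ (n + 2)) = X * heat s (X ^ (n + 1)) + (s * (n + 1)) • heat s (X ^ n) := by
  rw [pow_succ' _ (n + 1), heat_X_mul, ← heat_derivative, derivative_X_pow, Nat.add_sub_cancel,
    ← smul_eq_C_mul, map_smul, smul_smul]
  simp

/-! ### Rolle's theorem with a Gaussian weight. -/

/-- Rolle's theorem for `p` weighted by `exp ((x - z) ^ 2 / (2 s))`: distinct roots. -/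
theorem card_roots_toFinset_le_of_weighted_rolle {s : ℝ} (hs : 0 < s) (z : ℝ) {p : ℝ[X]}
    (hp : p ≠ 0) (hp' : (X - C z) * p + s • derivative p ≠ 0) :
    p.roots.toFinset.card ≤
      (((X - C z) * p + s • derivative p).roots.toFinset \ p.roots.toFinset).card + 1 := by
  refine Finset.card_le_sdiff_of_interleaved fun x hx y hy hxy hxy' => ?_
  rw [Multiset.mem_toFinset, mem_roots hp] at hx hy
  have hd : ∀ w, HasDerivAt (fun u => Real.exp ((u - z) ^ 2 / (2 * s)) * p.eval u)
      (Real.exp ((w - z) ^ 2 / (2 * s)) / s *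
        ((X - C z) * p + s • derivative p).eval w) w := by
    intro w
    have h1 : HasDerivAt (fun u => (u - z) ^ 2 / (2 * s)) ((w - z) / s) w := by
      have := (((hasDerivAt_id w).sub_const z).pow 2).div_const (2 * s)
      refine this.congr_deriv ?_
      simp only [id]
      field_simp
      simp [mul_comm]
    refine (h1.exp.mul (p.hasDerivAt w)).congr_deriv ?_
    simp
    field_simp
  obtain ⟨w, hw1, hw2⟩ := exists_hasDerivAt_eq_zero hxy
    (fun w _ => (hd w).continuousAt.continuousWithinAt)
    (by rw [hx.eq_zero, hy.eq_zero]; simp) (fun w _ => hd w)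
  refine ⟨w, ?_, hw1⟩
  rw [Multiset.mem_toFinset, mem_roots hp', IsRoot]
  refine (mul_eq_zero.1 hw2).resolve_left ?_
  positivity

theorem rootMultiplicity_sub_one_le_of_weighted (s z x : ℝ) (p : ℝ[X])
    (hp' : (X - C z) * p + s • derivative p ≠ 0) :
    p.rootMultiplicity x - 1 ≤ ((X - C z) * p + s • derivative p).rootMultiplicity x := by
  rw [le_rootMultiplicity_iff hp']
  refine dvd_add (Dvd.dvd.mul_left ?_ _) (Dvd.dvd.trans ?_ (dvd_smul_of_dvd _ dvd_rfl))
  · exact (pow_dvd_pow _ (Nat.sub_le _ _)).trans (p.pow_rootMultiplicity_dvd x)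
  · exact pow_sub_one_dvd_derivative_of_pow_dvd (p.pow_rootMultiplicity_dvd x)

/-- Rolle's theorem for `p` weighted by `exp ((x - z) ^ 2 / (2 s))`, with multiplicities. -/
theorem card_roots_le_of_weighted_rolle {s : ℝ} (hs : 0 < s) (z : ℝ) {p : ℝ[X]}
    (hp : p ≠ 0) (hp' : (X - C z) * p + s • derivative p ≠ 0) :
    Multiset.card p.roots ≤ Multiset.card ((X - C z) * p + s • derivative p).roots + 1 := by
  set r := (X - C z) * p + s • derivative p with hr
  calc
    Multiset.card p.roots = ∑ x ∈ p.roots.toFinset, p.roots.count x :=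
      (Multiset.toFinset_sum_count_eq _).symm
    _ = ∑ x ∈ p.roots.toFinset, (p.roots.count x - 1 + 1) :=
      (Eq.symm <| Finset.sum_congr rfl fun _ hx => tsub_add_cancel_of_le <|
        Nat.succ_le_iff.2 <| Multiset.count_pos.2 <| Multiset.mem_toFinset.1 hx)
    _ = (∑ x ∈ p.roots.toFinset, (p.rootMultiplicity x - 1)) + p.roots.toFinset.card := by
      simp only [Finset.sum_add_distrib, Finset.card_eq_sum_ones, count_roots]
    _ ≤ (∑ x ∈ p.roots.toFinset, r.rootMultiplicity x) +
          ((r.roots.toFinset \ p.roots.toFinset).card + 1) :=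
      add_le_add
        (Finset.sum_le_sum fun _ _ => rootMultiplicity_sub_one_le_of_weighted _ _ _ _ hp')
        (card_roots_toFinset_le_of_weighted_rolle hs z hp hp')
    _ ≤ (∑ x ∈ p.roots.toFinset, r.roots.count x) +
          ((∑ x ∈ r.roots.toFinset \ p.roots.toFinset, r.roots.count x) + 1) := by
      simp only [← count_roots]
      refine add_le_add_right (add_le_add_left ((Finset.card_eq_sum_ones _).trans_le ?_) _) _
      refine Finset.sum_le_sum fun x hx => Nat.succ_le_iff.2 <| ?_
      rw [Multiset.count_pos, ← Multiset.mem_toFinset]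
      exact (Finset.mem_sdiff.1 hx).1
    _ = Multiset.card r.roots + 1 := by
      rw [← add_assoc, ← Finset.sum_union Finset.disjoint_sdiff, Finset.union_sdiff_self_eq_union,
        ← Multiset.toFinset_sum_count_eq, ← Finset.sum_subset Finset.subset_union_right]
      intro x _ hx₂
      simpa only [Multiset.mem_toFinset, Multiset.count_eq_zero] using hx₂

end Polynomial

/-! ### Gaussian expectations of polynomials. -/

open MeasureTheory ProbabilityTheory Polynomial

theorem integrable_eval_gaussianReal (p : ℝ[X]) (m : ℝ) (v : ℝ≥0) :
    Integrable (fun y => p.eval y) (gaussianReal m v) := by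
  simp only [eval_eq_sum_range]
  refine integrable_finsetSum _ fun i _ => Integrable.const_mul ?_ _
  have := integrable_pow_of_mem_interior_integrableExpSet (X := id) (μ := gaussianReal m v)
    (by simp [integrableExpSet_id_gaussianReal]) i
  exact this

theorem integrable_eval_mul_gaussianPDFReal (p : ℝ[X]) (m : ℝ) {v : ℝ≥0} (hv : v ≠ 0) :
    Integrable (fun y => p.eval y * gaussianPDFReal m v y) := by
  have h := integrable_eval_gaussianReal p m v
  rw [gaussianReal_of_var_ne_zero m hv, integrable_withDensity_iff_integrable_smul'
    (measurable_gaussianPDF m v) (by simp [gaussianPDF_lt_top])] at h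
  simpa [toReal_gaussianPDF, mul_comm] using h

theorem hasDerivAt_gaussianPDFReal (m : ℝ) (v : ℝ≥0) (y : ℝ) :
    HasDerivAt (gaussianPDFReal m v) (-(y - m) / v * gaussianPDFReal m v y) y := by
  rcases eq_or_ne v 0 with rfl | hv
  · simp only [gaussianPDFReal_zero_var, Pi.zero_apply, mul_zero]
    exact hasDerivAt_const y (0 : ℝ)
  have hv' : (v : ℝ) ≠ 0 := by exact_mod_cast hv
  have h1 : HasDerivAt (fun u : ℝ => -(u - m) ^ 2 / (2 * v)) (-(y - m) / v) y := by
    have := (((hasDerivAt_id y).sub_const m).pow 2).neg.div_const (2 * (v : ℝ))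
    refine this.congr_deriv ?_
    simp only [id]
    field_simp
    simp [mul_comm]
  refine (h1.exp.const_mul (√(2 * Real.pi * v))⁻¹).congr_deriv ?_
  rw [gaussianPDFReal_def]
  ring

/-- Stein's identity for polynomials. -/
theorem integral_X_mul_gaussianReal (p : ℝ[X]) (m : ℝ) (v : ℝ≥0) :
    ∫ y, (X * p).eval y ∂gaussianReal m v =
      m * ∫ y, p.eval y ∂gaussianReal m v + v * ∫ y, (derivative p).eval y ∂gaussianReal m v := by
  rcases eq_or_ne v 0 with rfl | hv
  · simp [gaussianReal_zero_var]
  have hv' : (v : ℝ) ≠ 0 := by exact_mod_cast hv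
  have hd : ∀ y, HasDerivAt (fun y => p.eval y * gaussianPDFReal m v y)
      ((derivative p - C (v : ℝ)⁻¹ * ((X - C m) * p)).eval y * gaussianPDFReal m v y) y := by
    intro y
    refine ((p.hasDerivAt y).mul (hasDerivAt_gaussianPDFReal m v y)).congr_deriv ?_
    simp
    ring
  -- Integration by parts: the derivative of `p` times the density has integral zero.
  have h0 := integral_eq_zero_of_hasDerivAt_of_integrable hd
    (integrable_eval_mul_gaussianPDFReal _ m hv) (integrable_eval_mul_gaussianPDFReal _ m hv)
  have h1 : ∫ y, (derivative p - C (v : ℝ)⁻¹ * ((X - C m) * p)).eval y ∂gaussianReal m v = 0 := by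
    rw [integral_gaussianReal_eq_integral_smul hv, ← h0]
    simp only [smul_eq_mul, mul_comm]
  have h2 : ∀ y, (derivative p - C (v : ℝ)⁻¹ * ((X - C m) * p)).eval y =
      (derivative p).eval y - (v : ℝ)⁻¹ * ((X * p).eval y - m * p.eval y) := by
    intro y
    simp only [eval_sub, eval_mul, eval_C, eval_X]
    ring
  simp only [h2] at h1
  have i1 := integrable_eval_gaussianReal (derivative p) m v
  have i2 := integrable_eval_gaussianReal (X * p) m v
  have i3 := integrable_eval_gaussianReal p m v
  have i4 : Integrable (fun y => (X * p).eval y - m * p.eval y) (gaussianReal m v) :=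
    i2.sub (i3.const_mul m)
  rw [integral_sub i1 (i4.const_mul _), integral_const_mul,
    integral_sub i2 (i3.const_mul m), integral_const_mul] at h1
  field_simp at h1
  linarith

theorem integral_eval_gaussianReal_X_pow (m : ℝ) (v : ℝ≥0) (n : ℕ) :
    ∫ y, (X ^ n : ℝ[X]).eval y ∂gaussianReal m v = (heat v (X ^ n)).eval m := by
  induction n using Nat.strong_induction_on with
  | _ n ih =>
    match n with
    | 0 => simp [heat_one]
    | 1 =>
      have : heat v X = X := by simpa [heat_one] using heat_X_mul v 1
      simp [this]
    | n + 2 =>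
      rw [heat_X_pow_add_two, pow_succ' _ (n + 1), integral_X_mul_gaussianReal, ih (n + 1) (by lia)]
      have : (derivative (X ^ (n + 1) : ℝ[X])) = C ((n : ℝ) + 1) * X ^ n := by
        simp
      simp only [this, eval_mul, eval_C, integral_const_mul, ih n (by lia), eval_add, eval_X,
        eval_smul, smul_eq_mul]
      ring

/-- The heat operator evaluates Gaussian expectations of polynomials. -/
theorem integral_eval_gaussianReal (p : ℝ[X]) (m : ℝ) (v : ℝ≥0) :
    ∫ y, p.eval y ∂gaussianReal m v = (heat v p).eval m := by
  induction p using Polynomial.induction_on' with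
  | add p q hp hq =>
    simp only [eval_add, map_add]
    rw [integral_add (integrable_eval_gaussianReal p m v) (integrable_eval_gaussianReal q m v),
      hp, hq]
  | monomial n a =>
    rw [← C_mul_X_pow_eq_monomial, ← smul_eq_C_mul, map_smul]
    simp only [eval_smul, smul_eq_mul, integral_const_mul, integral_eval_gaussianReal_X_pow]

theorem integral_eval_mul_gaussianPDFReal (p : ℝ[X]) (m : ℝ) {v : ℝ≥0} (hv : v ≠ 0) :
    ∫ y, p.eval y * gaussianPDFReal m v y = (heat v p).eval m := by
  rw [← integral_eval_gaussianReal, integral_gaussianReal_eq_integral_smul hv]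
  simp only [smul_eq_mul, mul_comm]

/-! ### Real roots under the heat flow. -/

namespace Polynomial

theorem eval_heat_pos_of_nonneg {s : ℝ} (hs : 0 < s) {w : ℝ[X]} (hw : w ≠ 0)
    (h0 : ∀ x, 0 ≤ w.eval x) (x : ℝ) : 0 < (heat s w).eval x := by
  lift s to ℝ≥0 using hs.le
  have hs' : s ≠ 0 := by rintro rfl; simp at hs
  rw [← integral_eval_gaussianReal]
  refine (integral_nonneg h0).lt_of_ne fun h => hw ?_
  have h1 := (integral_eq_zero_iff_of_nonneg h0 (integrable_eval_gaussianReal w x s)).1 h.symm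
  have h2 := (gaussianReal_absolutelyContinuous' x hs').ae_eq h1
  have h3 : (fun y => w.eval y) = 0 := (Continuous.ae_eq_iff_eq _ w.continuous continuous_zero).1 h2
  exact Polynomial.funext fun y => by simpa using congrFun h3 y

/-- A polynomial without real roots has constant sign. -/
theorem exists_sign_of_roots_eq_zero {v : ℝ[X]} (hv : v ≠ 0) (h : v.roots = 0) :
    ∃ σ : ℝ, (σ = 1 ∨ σ = -1) ∧ ∀ x, 0 < σ * v.eval x := by
  have hne : ∀ x, v.eval x ≠ 0 := fun x hx => by
    have : x ∈ v.roots := (mem_roots hv).2 hx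
    simp [h] at this
  have hivt : ∀ x y, v.eval x < 0 → ¬ 0 < v.eval y := fun x y hx hy => by
    obtain ⟨z, hz⟩ := mem_range_of_exists_le_of_exists_ge v.continuous ⟨x, hx.le⟩ ⟨y, hy.le⟩
    exact hne z hz
  rcases (hne 0).lt_or_gt with h0 | h0
  · exact ⟨-1, Or.inr rfl, fun x => by
      linarith [(hne x).lt_or_gt.resolve_right (hivt 0 x h0)]⟩
  · exact ⟨1, Or.inl rfl, fun x => by
      linarith [(hne x).lt_or_gt.resolve_left fun hx => hivt x 0 hx h0]⟩

/-- Descartes' rule for the heat flow: it has at most as many real roots, with multiplicity, as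
the initial polynomial has sign changes. -/
theorem card_roots_heat_prod_mul_le {s : ℝ} (hs : 0 < s) (M : Multiset ℝ) {w : ℝ[X]} (hw : w ≠ 0)
    (h0 : ∀ x, 0 ≤ w.eval x) :
    Multiset.card (heat s ((M.map fun a => X - C a).prod * w)).roots ≤ Multiset.card M := by
  induction M using Multiset.induction_on generalizing w with
  | empty =>
    have : (heat s w).roots = 0 := by
      refine Multiset.eq_zero_of_forall_notMem fun x hx => ?_
      have := isRoot_of_mem_roots hx
      exact (eval_heat_pos_of_nonneg hs hw h0 x).ne' this
    simp [this]
  | cons z M ih =>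
    set q := (((z ::ₘ M).map fun a => X - C a).prod * w) with hq
    have hX : X - C z ≠ 0 := X_sub_C_ne_zero z
    have hp : q ≠ 0 := by
      refine mul_ne_zero (Multiset.prod_ne_zero fun h => ?_) hw
      obtain ⟨a, -, ha⟩ := Multiset.mem_map.1 h
      exact X_sub_C_ne_zero a ha
    have h1 : heat s ((X - C z) * q) ≠ 0 := heat_ne_zero s (mul_ne_zero hX hp)
    -- The induction hypothesis is applied not to `q` but to `(X - z) q`, in which the root `z` is
    -- squared and absorbed into the nonnegative factor; Rolle then returns to `q` at the cost of
    -- one root.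
    have h2 := ih (w := (X - C z) ^ 2 * w) (mul_ne_zero (pow_ne_zero 2 hX) hw)
      (fun x => by rw [eval_mul, eval_pow]; exact mul_nonneg (sq_nonneg _) (h0 x))
    have h3 : (M.map fun a => X - C a).prod * ((X - C z) ^ 2 * w) = (X - C z) * q := by
      rw [hq, Multiset.map_cons, Multiset.prod_cons]
      ring
    rw [h3] at h2
    rw [heat_X_sub_C_mul] at h1 h2
    have h4 := card_roots_le_of_weighted_rolle hs z (heat_ne_zero s hp) h1
    rw [Multiset.card_cons]
    lia

/-- The heat flow destroys every multiple root. -/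
theorem card_roots_heat_add_le {s : ℝ} (hs : 0 < s) {q : ℝ[X]} (hq : q ≠ 0) (A : Finset ℝ)
    (hA : ∀ a ∈ A, q.IsRoot a ∧ (derivative q).IsRoot a) :
    Multiset.card (heat s q).roots + 2 * A.card ≤ Multiset.card q.roots := by
  have hle : A.val + A.val ≤ q.roots := by
    rw [Multiset.le_iff_count]
    intro a
    rw [Multiset.count_add, count_roots]
    have hc := Multiset.nodup_iff_count_le_one.1 A.nodup a
    by_cases ha : a ∈ A
    · have := (one_lt_rootMultiplicity_iff_isRoot hq).2 (hA a ha)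
      lia
    · rw [Multiset.count_eq_zero_of_notMem (by simpa using ha)]
      lia
  obtain ⟨M, hM⟩ := Multiset.le_iff_exists_add.1 hle
  obtain ⟨v, hv, -, hv0⟩ := exists_prod_multiset_X_sub_C_mul q
  have hvne : v ≠ 0 := by rintro rfl; simp at hv; exact hq hv.symm
  obtain ⟨σ, hσ, hpos⟩ := exists_sign_of_roots_eq_zero hvne hv0
  have hσ0 : σ ≠ 0 := by rcases hσ with rfl | rfl <;> norm_num
  have hP : (A.val.map fun a => X - C a).prod ≠ (0 : ℝ[X]) := by
    refine Multiset.prod_ne_zero fun h => ?_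
    obtain ⟨a, -, ha⟩ := Multiset.mem_map.1 h
    exact X_sub_C_ne_zero a ha
  set P := (A.val.map fun a => X - C a).prod with hPdef
  have hw : P ^ 2 * (C σ * v) ≠ 0 :=
    mul_ne_zero (pow_ne_zero 2 hP) (mul_ne_zero (by simpa using hσ0) hvne)
  have h1 := card_roots_heat_prod_mul_le hs M hw (fun x => by
    rw [eval_mul, eval_pow, eval_mul, eval_C]
    exact mul_nonneg (sq_nonneg _) (hpos x).le)
  -- The doubled roots and the rootless cofactor form the nonnegative factor `P² σ v`, so only the
  -- roots in `M` can survive.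
  have h2 : (M.map fun a => X - C a).prod * (P ^ 2 * (C σ * v)) = C σ * q := by
    conv_rhs => rw [← hv, hM, Multiset.map_add, Multiset.map_add, Multiset.prod_add,
      Multiset.prod_add, ← hPdef]
    ring
  rw [h2, ← smul_eq_C_mul, map_smul, roots_smul_nonzero _ hσ0] at h1
  rw [hM, Multiset.card_add, Multiset.card_add]
  simp only [Finset.card_val]
  lia

theorem natDegree_heat (s : ℝ) (q : ℝ[X]) : (heat s q).natDegree = q.natDegree := by
  refine (natDegree_heat_le s q).antisymm ?_
  have := natDegree_heat_le (-s) (heat s q)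
  rwa [heat_heat, neg_add_cancel, heat_zero] at this

/-- Each point of a finite set at earlier times where the caloric extension of `q` has a multiple
root takes two off the number of real roots of `q`. -/
theorem card_roots_add_two_mul_card_le {q : ℝ[X]} (hq : q ≠ 0) (τ : ℝ) (A : Finset (ℝ × ℝ))
    (hτ : ∀ a ∈ A, a.2 < τ)
    (hA : ∀ a ∈ A, (heat (a.2 - τ) q).IsRoot a.1 ∧ (derivative (heat (a.2 - τ) q)).IsRoot a.1) :
    Multiset.card q.roots + 2 * A.card ≤ q.natDegree := by
  induction hn : A.card using Nat.strong_induction_on generalizing A q τ with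
  | _ n ih =>
    rcases A.eq_empty_or_nonempty with rfl | hne
    · simp at hn
      subst hn
      simpa using card_roots' q
    -- Split off the points of latest time `t`: the flow from `t` to `τ` removes their double roots,
    -- and the earlier points are handled with `t` in place of `τ`.
    obtain ⟨b, hb, hmax⟩ := A.exists_max_image (fun a => a.2) hne
    set t := b.2 with ht
    set A₁ := A.filter (fun a => a.2 = t) with hA₁
    set A₂ := A.filter (fun a => ¬ a.2 = t) with hA₂
    have hcard : A₁.card + A₂.card = n := by
      rw [hA₁, hA₂, Finset.card_filter_add_card_filter_not, hn]
    have h1pos : 0 < A₁.card := Finset.card_pos.2 ⟨b, by simp [hA₁, hb, ht]⟩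
    set Q := heat (t - τ) q with hQ
    have hQ0 : Q ≠ 0 := heat_ne_zero _ hq
    have e : ∀ r, heat (r - t) Q = heat (r - τ) q := fun r => by
      rw [hQ, heat_heat]; congr 2; ring
    have h2 := ih A₂.card (by lia) hQ0 t A₂
      (fun a ha => (hmax a (Finset.mem_filter.1 ha).1).lt_of_ne (Finset.mem_filter.1 ha).2)
      (fun a ha => by rw [e]; exact hA a (Finset.mem_filter.1 ha).1) rfl
    have hinj : (A₁.image Prod.fst).card = A₁.card := by
      refine Finset.card_image_of_injOn fun a ha c hc hac => ?_
      have h1 := (Finset.mem_filter.1 ha).2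
      have h2 := (Finset.mem_filter.1 hc).2
      exact Prod.ext hac (h1.trans h2.symm)
    have h3 := card_roots_heat_add_le (s := τ - t) (sub_pos.2 (hτ b hb)) hQ0 (A₁.image Prod.fst)
      (fun x hx => by
        obtain ⟨a, ha, rfl⟩ := Finset.mem_image.1 hx
        obtain ⟨h1, h2⟩ := Finset.mem_filter.1 ha
        have := hA a h1
        rwa [h2] at this)
    rw [hQ, heat_heat, show τ - t + (t - τ) = 0 by ring, heat_zero, ← hQ, hinj] at h3
    rw [hQ, natDegree_heat, ← hQ] at h2
    lia

end Polynomial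

/-! ### Sign changes of real functions. -/

/-- A list of increasing reals at which `f` has alternating strict signs. -/
def AlternatingChain (f : ℝ → ℝ) (l : List ℝ) : Prop :=
  l.IsChain (fun a b => a < b ∧ f a * f b < 0)

/-- `f` has at most `q` sign changes. -/
def SignChangesLE (f : ℝ → ℝ) (q : ℕ) : Prop :=
  ∀ l, AlternatingChain f l → l.length ≤ q + 1

theorem mul_neg_of_mul_pos_of_mul_neg {a b c d : ℝ} (h1 : 0 < a * b) (h2 : 0 < c * d)
    (h3 : b * d < 0) : a * c < 0 := by
  by_contra! h
  nlinarith [mul_nonneg h (mul_pos h1 h2).le, mul_pos h1 h2, mul_neg_of_pos_of_neg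
    (mul_pos h1 h2) h3]

theorem mul_pos_of_mul_pos_of_mul_pos {a b c : ℝ} (h1 : 0 < a * b) (h2 : 0 < a * c) :
    0 < b * c := by
  by_contra! h
  have : 0 < (a * b) * (a * c) := mul_pos h1 h2
  nlinarith [mul_nonneg (sq_nonneg a) (neg_nonneg.2 h)]

/-- By the mean value theorem `h` takes the sign of `f b` somewhere between `a` and `b`. Recording
that sign and the location of `c` is what lets the induction link consecutive points. -/
theorem AlternatingChain.exists_rolle {f h E E' : ℝ → ℝ} (hE : ∀ x, 0 < E x) (hE' : ∀ x, 0 < E' x)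
    (hd : ∀ x, HasDerivAt (fun u => E u * f u) (E' x * h x) x) (l : List ℝ) (a b : ℝ)
    (hl : AlternatingChain f (a :: b :: l)) :
    ∃ c l', a < c ∧ c < b ∧ 0 < h c * f b ∧ l'.length = l.length ∧
      AlternatingChain h (c :: l') := by
  induction l generalizing a b with
  | nil =>
    obtain ⟨⟨hab, hf⟩, -⟩ := List.isChain_cons_cons.1 hl
    obtain ⟨c, hc, hcd⟩ := exists_hasDerivAt_eq_slope (fun u => E u * f u) (fun x => E' x * h x) hab
      (fun x _ => (hd x).continuousAt.continuousWithinAt) (fun x _ => hd x)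
    refine ⟨c, [], hc.1, hc.2, ?_, rfl, List.isChain_singleton _⟩
    rw [eq_div_iff (sub_pos.2 hab).ne'] at hcd
    have h1 : 0 < (E b * f b - E a * f a) * f b := by
      nlinarith [mul_neg_of_pos_of_neg (hE a) hf, mul_nonneg (hE b).le (sq_nonneg (f b))]
    rw [← hcd] at h1
    have h2 : 0 < E' c * (b - a) := mul_pos (hE' c) (sub_pos.2 hab)
    exact pos_of_mul_pos_right (a := E' c * (b - a)) (by linarith) h2.le
  | cons d l ih =>
    obtain ⟨⟨hab, hf⟩, hbd⟩ := List.isChain_cons_cons.1 hl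
    obtain ⟨c', l', h1, h2, h3, h4, h5⟩ := ih b d hbd
    obtain ⟨c, hc, hcd⟩ := exists_hasDerivAt_eq_slope (fun u => E u * f u) (fun x => E' x * h x) hab
      (fun x _ => (hd x).continuousAt.continuousWithinAt) (fun x _ => hd x)
    rw [eq_div_iff (sub_pos.2 hab).ne'] at hcd
    have g1 : 0 < (E b * f b - E a * f a) * f b := by
      nlinarith [mul_neg_of_pos_of_neg (hE a) hf, mul_nonneg (hE b).le (sq_nonneg (f b))]
    rw [← hcd] at g1
    have g2 : 0 < E' c * (b - a) := mul_pos (hE' c) (sub_pos.2 hab)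
    have g3 : 0 < h c * f b := pos_of_mul_pos_right (a := E' c * (b - a)) (by linarith) g2.le
    refine ⟨c, c' :: l', hc.1, hc.2, g3, by simp [h4], List.isChain_cons_cons.2
      ⟨⟨hc.2.trans h1, mul_neg_of_mul_pos_of_mul_neg g3 h3 ?_⟩, h5⟩⟩
    exact (List.isChain_cons_cons.1 hbd).1.2

/-- Rolle's theorem for sign changes. -/
theorem SignChangesLE.of_deriv {f h E E' : ℝ → ℝ} (hE : ∀ x, 0 < E x) (hE' : ∀ x, 0 < E' x)
    (hd : ∀ x, HasDerivAt (fun u => E u * f u) (E' x * h x) x) {q : ℕ} (hq : SignChangesLE h q) :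
    SignChangesLE f (q + 1) := by
  intro l hl
  match l with
  | [] => simp
  | [a] => simp
  | a :: b :: l =>
    obtain ⟨c, l', -, -, -, h4, h5⟩ := hl.exists_rolle hE hE' hd
    have := hq _ h5
    simp only [List.length_cons] at this ⊢
    lia

theorem signChangesLE_zero_of_nonneg {f : ℝ → ℝ} (hf : ∀ x, 0 ≤ f x) : SignChangesLE f 0 := by
  intro l hl
  match l with
  | [] => simp
  | [a] => simp
  | a :: b :: l =>
    exact absurd (List.isChain_cons_cons.1 hl).1.2 (not_lt.2 (mul_nonneg (hf a) (hf b)))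

theorem AlternatingChain.of_sub_mul {f : ℝ → ℝ} {z : ℝ} (l : List ℝ) (y : ℝ) (hy : z < y)
    (hl : AlternatingChain (fun x => (x - z) * f x) (y :: l)) : AlternatingChain f (y :: l) := by
  induction l generalizing y with
  | nil => exact List.isChain_singleton _
  | cons w l ih =>
    obtain ⟨⟨h1, h2⟩, h3⟩ := List.isChain_cons_cons.1 hl
    refine List.isChain_cons_cons.2 ⟨⟨h1, ?_⟩, ih w (hy.trans h1) h3⟩
    have h4 : 0 < (y - z) * (w - z) := mul_pos (sub_pos.2 hy) (sub_pos.2 (hy.trans h1))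
    by_contra! h5
    nlinarith [mul_nonneg h4.le h5]

/-- The factor vanishes at the first sign change `z`, so the product loses that change. Continuity
plays no role: `z` is an infimum, and a point `b` of sign opposite to `x₀` is found arbitrarily
close to it on the right. -/
theorem SignChangesLE.sub_mul {f : ℝ → ℝ} {q : ℕ} (hf : SignChangesLE f (q + 1)) {x₀ x₁ : ℝ}
    {l : List ℝ} (hl : AlternatingChain f (x₀ :: x₁ :: l)) (hlen : l.length = q) :
    ∃ z, SignChangesLE (fun x => (x - z) * f x) q := by
  obtain ⟨⟨h01, hf01⟩, htail⟩ := List.isChain_cons_cons.1 hl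
  set B := {x | x₀ < x ∧ f x₀ * f x < 0} with hB
  have hBne : B.Nonempty := ⟨x₁, h01, hf01⟩
  have hBdd : BddBelow B := ⟨x₀, fun x hx => hx.1.le⟩
  have hf0 : f x₀ ≠ 0 := by rintro h; simp [h] at hf01
  set z := sInf B with hz
  have hxz : x₀ ≤ z := le_csInf hBne fun x hx => hx.1.le
  -- Left of `z` the sign of `f x₀` persists: a violation left of `x₀` would prolong the maximal
  -- chain, one right of it would lie in `B`.
  have hleft : ∀ y, y < z → 0 ≤ f x₀ * f y := by
    intro y hy
    by_contra! h
    rcases lt_trichotomy y x₀ with h1 | rfl | h1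
    · have : AlternatingChain f (y :: x₀ :: x₁ :: l) :=
        List.isChain_cons_cons.2 ⟨⟨h1, by linarith⟩, hl⟩
      have := hf _ this
      simp only [List.length_cons] at this
      lia
    · nlinarith [mul_self_nonneg (f y)]
    · exact absurd (csInf_le hBdd (show y ∈ B from ⟨h1, h⟩)) (not_le.2 hy)
  have hright : ∀ w, z < w → ∃ b, x₀ < b ∧ z ≤ b ∧ b < w ∧ f x₀ * f b < 0 := by
    intro w hw
    obtain ⟨b, hb, hbw⟩ := exists_lt_of_csInf_lt hBne hw
    exact ⟨b, hb.1, csInf_le hBdd hb, hbw, hb.2⟩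
  have hneg : ∀ {u b : ℝ}, 0 < f x₀ * f u → f x₀ * f b < 0 → f u * f b < 0 := by
    intro u b h1 h2
    refine mul_neg_of_mul_pos_of_mul_neg (b := f x₀) (d := -f x₀) (by linarith)
      (by linarith) ?_
    nlinarith [mul_self_pos.2 hf0]
  refine ⟨z, fun m hm => ?_⟩
  match m with
  | [] => simp
  | [y] => simp
  | y :: y₂ :: m =>
    obtain ⟨⟨hy, hfy⟩, hm'⟩ := List.isChain_cons_cons.1 hm
    have hyz : y ≠ z := by rintro rfl; simp at hfy
    have hfy0 : f y ≠ 0 := by intro h; simp [h] at hfy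
    have hfy20 : f y₂ ≠ 0 := by intro h; simp [h] at hfy
    have hy2z : y₂ ≠ z := by intro h; simp [h] at hfy
    rcases hyz.lt_or_gt with hlt | hgt
    -- A chain for the product that crosses `z` has equal signs of `f` at `y` and `y₂`; inserting
    -- `b` gives a chain for `f` that is one longer.
    · have hpos : 0 < f x₀ * f y := (hleft y hlt).lt_of_ne (mul_ne_zero hf0 hfy0).symm
      have hy2 : z < y₂ := by
        refine hy2z.lt_or_gt.resolve_left fun h => ?_
        have h1 : 0 < f x₀ * f y₂ := (hleft y₂ h).lt_of_ne (mul_ne_zero hf0 hfy20).symm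
        have h2 := mul_pos_of_mul_pos_of_mul_pos hpos h1
        nlinarith [mul_pos (mul_pos (sub_pos.2 hlt) (sub_pos.2 h)) h2]
      have hsame : 0 < f y * f y₂ := by
        by_contra! h
        nlinarith [mul_nonneg (mul_pos (sub_pos.2 hlt) (sub_pos.2 hy2)).le (neg_nonneg.2 h)]
      have hpos2 : 0 < f x₀ * f y₂ := by
        refine mul_pos_of_mul_pos_of_mul_pos (a := f y) (by linarith) hsame
      obtain ⟨b, hb0, hzb, hb2, hfb⟩ := hright y₂ hy2
      have hc : AlternatingChain f (y :: b :: y₂ :: m) :=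
        List.isChain_cons_cons.2 ⟨⟨hlt.trans_le hzb, hneg hpos hfb⟩, List.isChain_cons_cons.2
          ⟨⟨hb2, by rw [mul_comm]; exact hneg hpos2 hfb⟩, AlternatingChain.of_sub_mul m y₂ hy2 hm'⟩⟩
      have := hf _ hc
      simp only [List.length_cons] at this ⊢
      lia
    -- The chain lies right of `z`, so it alternates for `f` too; it is prolonged on the left by
    -- `x₀`, with `b` in between when the signs require it.
    · have hc := AlternatingChain.of_sub_mul _ y hgt hm
      rcases (mul_ne_zero hf0 hfy0).lt_or_gt with h | h
      · have := hf _ (List.isChain_cons_cons.2 ⟨⟨hxz.trans_lt hgt, h⟩, hc⟩ :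
          AlternatingChain f (x₀ :: y :: y₂ :: m))
        simp only [List.length_cons] at this ⊢
        lia
      · obtain ⟨b, hb0, hzb, hb2, hfb⟩ := hright y hgt
        have := hf _ (List.isChain_cons_cons.2 ⟨⟨hb0, hfb⟩, List.isChain_cons_cons.2
          ⟨⟨hb2, by rw [mul_comm]; exact hneg h hfb⟩, hc⟩⟩ :
            AlternatingChain f (x₀ :: b :: y :: y₂ :: m))
        simp only [List.length_cons] at this ⊢
        lia

/-- A function with at most `q` sign changes has the sign of a split polynomial of degree at most
`q`. -/
theorem SignChangesLE.exists_polynomial {f : ℝ → ℝ} {q : ℕ} (hf : SignChangesLE f q) :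
    ∃ D : ℝ[X], D ≠ 0 ∧ Multiset.card D.roots = D.natDegree ∧ D.natDegree ≤ q ∧
      ∀ x, 0 ≤ D.eval x * f x := by
  induction q generalizing f with
  | zero =>
    by_cases h : ∃ x₀, f x₀ ≠ 0
    · obtain ⟨x₀, h0⟩ := h
      refine ⟨C (f x₀), by simpa using h0, by simp, by simp, fun x => ?_⟩
      rw [eval_C]
      by_contra! hneg
      rcases lt_trichotomy x x₀ with h1 | rfl | h1
      · simpa using hf [x, x₀] (List.isChain_pair.2 ⟨h1, by linarith⟩)
      · nlinarith [mul_self_nonneg (f x)]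
      · simpa using hf [x₀, x] (List.isChain_pair.2 ⟨h1, by linarith⟩)
    · push Not at h
      exact ⟨1, one_ne_zero, by simp, by simp, fun x => by simp [h x]⟩
  | succ q ih =>
    by_cases h : SignChangesLE f q
    · obtain ⟨D, h1, h2, h3, h4⟩ := ih h
      exact ⟨D, h1, h2, h3.trans (Nat.le_succ q), h4⟩
    · simp only [SignChangesLE, not_forall, not_le] at h
      obtain ⟨l, hl, hlen⟩ := h
      match l with
      | [] => simp at hlen
      | [a] => simp at hlen
      | a :: b :: l =>
        have hlen' := hf _ hl
        simp only [List.length_cons] at hlen hlen'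
        obtain ⟨z, hz⟩ := hf.sub_mul hl (by lia)
        obtain ⟨D, h1, h2, h3, h4⟩ := ih hz
        have hX : X - C z ≠ 0 := X_sub_C_ne_zero z
        refine ⟨(X - C z) * D, mul_ne_zero hX h1, ?_, ?_, fun x => ?_⟩
        · rw [roots_mul (mul_ne_zero hX h1), natDegree_mul hX h1, Multiset.card_add, h2]
          simp
        · rw [natDegree_mul hX h1, natDegree_X_sub_C]
          lia
        · have := h4 x
          simp only [eval_mul, eval_sub, eval_X, eval_C]
          nlinarith

/-! ### Sign patterns of combinations of Gaussian densities. -/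

/-- The integral of `q` times a Gaussian kernel of variance `s` against a Gaussian measure. -/
noncomputable def gaussianSmoothing (s : ℝ≥0) (m : ℝ) (r : ℝ≥0) (q : ℝ[X]) (x : ℝ) : ℝ :=
  ∫ y, q.eval y * gaussianPDFReal y s x ∂gaussianReal m r

theorem gaussianPDFReal_le_inv_sqrt (m : ℝ) (v : ℝ≥0) (x : ℝ) :
    gaussianPDFReal m v x ≤ (√(2 * Real.pi * v))⁻¹ := by
  rw [gaussianPDFReal_def]
  refine mul_le_of_le_one_right (by positivity) (Real.exp_le_one_iff.2 ?_)
  rw [neg_div, neg_nonpos]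
  positivity

/-- The bound does not depend on the variance: away from its mean a Gaussian density is bounded
however narrow it is. It serves for domination under the integral and for separating components. -/
theorem abs_sub_mul_gaussianPDFReal_le (m : ℝ) {v : ℝ≥0} (hv : v ≠ 0) (x : ℝ) :
    |x - m| * gaussianPDFReal m v x ≤ 1 / 2 := by
  have hv' : 0 < (v : ℝ) := by positivity
  set d := |x - m| with hd
  have hsq : (x - m) ^ 2 = d ^ 2 := (sq_abs _).symm
  have hpi : √(2 * Real.pi * v) ^ 2 = 2 * Real.pi * v := Real.sq_sqrt (by positivity)
  have hpos : 0 < √(2 * Real.pi * v) := Real.sqrt_pos.2 (by positivity)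
  simp only [gaussianPDFReal_def]
  rw [hsq, neg_div, Real.exp_neg]
  have h1 : d ^ 2 / (2 * v) + 1 ≤ Real.exp (d ^ 2 / (2 * v)) := Real.add_one_le_exp _
  have h2 : 0 < Real.exp (d ^ 2 / (2 * v)) := Real.exp_pos _
  rw [← mul_inv, ← div_eq_mul_inv, div_le_iff₀ (by positivity)]
  have h3 : 2 * d ≤ √(2 * Real.pi * v) * (d ^ 2 / (2 * v) + 1) := by
    rw [div_add_one (by positivity), mul_div_assoc', le_div_iff₀ (by positivity)]
    set w := √(2 * Real.pi * v)
    have h4 : 6 * (v : ℝ) ≤ w ^ 2 := by rw [hpi]; nlinarith [Real.pi_gt_three]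
    have h5 : 2 * (v : ℝ) ≤ w ^ 2 := by linarith
    by_contra! h
    have h6 : 0 ≤ d := abs_nonneg _
    have h7 : w ^ 2 * (d ^ 2 + 2 * v) < w * (2 * d * (2 * v)) := by nlinarith
    nlinarith [sq_nonneg (w * d - 2 * v)]
  nlinarith

theorem integrable_eval_mul_kernel (s : ℝ≥0) (m : ℝ) (r : ℝ≥0) (q : ℝ[X]) (x : ℝ) :
    Integrable (fun y => q.eval y * gaussianPDFReal y s x) (gaussianReal m r) := by
  refine (integrable_eval_gaussianReal q m r).mul_bdd (c := (√(2 * Real.pi * s))⁻¹)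
    ?_ (Filter.Eventually.of_forall fun y => ?_)
  · refine Continuous.aestronglyMeasurable ?_
    simp only [gaussianPDFReal_def]
    fun_prop
  · rw [Real.norm_of_nonneg (gaussianPDFReal_nonneg _ _ _)]
    exact gaussianPDFReal_le_inv_sqrt _ _ _

theorem gaussianSmoothing_add (s : ℝ≥0) (m : ℝ) (r : ℝ≥0) (p q : ℝ[X]) (x : ℝ) :
    gaussianSmoothing s m r (p + q) x =
      gaussianSmoothing s m r p x + gaussianSmoothing s m r q x := by
  simp only [gaussianSmoothing, eval_add, add_mul]
  exact integral_add (integrable_eval_mul_kernel s m r p x) (integrable_eval_mul_kernel s m r q x)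

theorem gaussianSmoothing_C_mul (s : ℝ≥0) (m : ℝ) (r : ℝ≥0) (c : ℝ) (q : ℝ[X]) (x : ℝ) :
    gaussianSmoothing s m r (C c * q) x = c * gaussianSmoothing s m r q x := by
  simp only [gaussianSmoothing, eval_mul, eval_C, mul_assoc, integral_const_mul]

theorem gaussianSmoothing_zero_var (s : ℝ≥0) (m : ℝ) (q : ℝ[X]) (x : ℝ) :
    gaussianSmoothing s m 0 q x = q.eval m * gaussianPDFReal m s x := by
  rw [gaussianSmoothing, gaussianReal_zero_var, integral_dirac]

theorem gaussianPDFReal_mul_gaussianPDFReal {s r : ℝ≥0} (hs : s ≠ 0) (hr : r ≠ 0) (m x y : ℝ) :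
    gaussianPDFReal m r y * gaussianPDFReal y s x =
      gaussianPDFReal m (s + r) x *
        gaussianPDFReal ((r * x + s * m) / (s + r)) (s * r / (s + r)) y := by
  have hs' : 0 < (s : ℝ) := by positivity
  have hr' : 0 < (r : ℝ) := by positivity
  simp only [gaussianPDFReal_def, NNReal.coe_add, NNReal.coe_mul, NNReal.coe_div]
  rw [mul_mul_mul_comm, mul_mul_mul_comm (√(2 * Real.pi * (s + r)))⁻¹, ← mul_inv, ← mul_inv,
    ← Real.exp_add, ← Real.exp_add, ← Real.sqrt_mul (by positivity), ← Real.sqrt_mul (by positivity)]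
  have e1 : 2 * Real.pi * r * (2 * Real.pi * s) =
      2 * Real.pi * (s + r) * (2 * Real.pi * (s * r / (s + r))) := by
    field_simp
  have e2 : -(y - m) ^ 2 / (2 * r) + -(x - y) ^ 2 / (2 * s) = -(x - m) ^ 2 / (2 * (s + r)) +
      -(y - (r * x + s * m) / (s + r)) ^ 2 / (2 * (s * r / (s + r))) := by
    field_simp
    ring
  rw [e1, e2]

theorem gaussianSmoothing_one {s : ℝ≥0} (hs : s ≠ 0) (m : ℝ) (r : ℝ≥0) (x : ℝ) :
    gaussianSmoothing s m r 1 x = gaussianPDFReal m (s + r) x := by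
  rcases eq_or_ne r 0 with rfl | hr
  · simp [gaussianSmoothing_zero_var]
  rw [gaussianSmoothing, integral_gaussianReal_eq_integral_smul hr]
  simp only [eval_one, one_mul, smul_eq_mul, gaussianPDFReal_mul_gaussianPDFReal hs hr,
    integral_const_mul]
  rw [integral_gaussianPDFReal_eq_one, mul_one]
  positivity

theorem hasDerivAt_gaussianSmoothing {s : ℝ≥0} (hs : s ≠ 0) (m : ℝ) (r : ℝ≥0) (q : ℝ[X]) (x : ℝ) :
    HasDerivAt (gaussianSmoothing s m r q)
      ((gaussianSmoothing s m r (X * q) x - x * gaussianSmoothing s m r q x) / s) x := by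
  have hs' : 0 < (s : ℝ) := by positivity
  have hcont : ∀ x, Continuous fun y => gaussianPDFReal y s x := fun x => by
    simp only [gaussianPDFReal_def]
    fun_prop
  have key := hasDerivAt_integral_of_dominated_loc_of_deriv_le (μ := gaussianReal m r)
    (F := fun x y => q.eval y * gaussianPDFReal y s x)
    (F' := fun x y => q.eval y * (-(x - y) / s * gaussianPDFReal y s x))
    (bound := fun y => |q.eval y| * (1 / s)) (x₀ := x) (s := Set.univ) Filter.univ_mem
    (Filter.Eventually.of_forall fun x => (integrable_eval_mul_kernel s m r q x).aestronglyMeasurable)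
    (integrable_eval_mul_kernel s m r q x)
    (Continuous.aestronglyMeasurable (by have := hcont x; fun_prop))
    (Filter.Eventually.of_forall fun y x _ => by
      rw [Real.norm_eq_abs, abs_mul, abs_mul, abs_div, abs_neg, abs_of_pos hs',
        abs_of_nonneg (gaussianPDFReal_nonneg y s x)]
      refine mul_le_mul_of_nonneg_left ?_ (abs_nonneg _)
      rw [div_mul_eq_mul_div]
      gcongr
      linarith [abs_sub_mul_gaussianPDFReal_le y hs x])
    ((integrable_eval_gaussianReal q m r).abs.mul_const _)
    (Filter.Eventually.of_forall fun y x _ => (hasDerivAt_gaussianPDFReal y s x).const_mul _)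
  refine key.2.congr_deriv ?_
  have e : ∀ y, q.eval y * (-(x - y) / s * gaussianPDFReal y s x) =
      ((X * q).eval y * gaussianPDFReal y s x - x * (q.eval y * gaussianPDFReal y s x)) / s := by
    intro y
    rw [eval_mul, eval_X]
    ring
  simp only [e, integral_div]
  rw [integral_sub (integrable_eval_mul_kernel s m r (X * q) x)
    ((integrable_eval_mul_kernel s m r q x).const_mul x), integral_const_mul]
  rfl

section

variable {ι : Type*}

/-- Multiplying the initial measure by a linear factor costs at most one sign change. -/
theorem signChangesLE_sum_gaussianSmoothing (J : Finset ι) (a x : ι → ℝ) (r : ι → ℝ≥0)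
    {s : ℝ≥0} (hs : s ≠ 0) (M : Multiset ℝ) (w : ℝ[X]) {k : ℕ}
    (h : SignChangesLE (fun y => ∑ j ∈ J, a j *
      gaussianSmoothing s (x j) (r j) ((M.map fun z => X - C z).prod * w) y) k) :
    SignChangesLE (fun y => ∑ j ∈ J, a j * gaussianSmoothing s (x j) (r j) w y)
      (k + Multiset.card M) := by
  have hs' : 0 < (s : ℝ) := by positivity
  induction M using Multiset.induction_on generalizing w with
  | empty => simpa using h
  | cons z M ih =>
    rw [Multiset.map_cons, Multiset.prod_cons, mul_comm (X - C z), mul_assoc] at h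
    rw [Multiset.card_cons, ← add_assoc]
    refine SignChangesLE.of_deriv (E := fun u => Real.exp ((u - z) ^ 2 / (2 * s)))
      (E' := fun u => Real.exp ((u - z) ^ 2 / (2 * s)) / s) (fun u => by positivity)
      (fun u => by positivity) (fun u => ?_) (ih _ h)
    have h1 : HasDerivAt (fun u : ℝ => (u - z) ^ 2 / (2 * s)) ((u - z) / s) u := by
      have := (((hasDerivAt_id u).sub_const z).pow 2).div_const (2 * (s : ℝ))
      refine this.congr_deriv ?_
      simp only [id]
      field_simp
      simp [mul_comm]
    have h2 : HasDerivAt (fun y => ∑ j ∈ J, a j * gaussianSmoothing s (x j) (r j) w y)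
        (∑ j ∈ J, a j * ((gaussianSmoothing s (x j) (r j) (X * w) u -
          u * gaussianSmoothing s (x j) (r j) w u) / s)) u :=
      HasDerivAt.fun_sum fun j _ => (hasDerivAt_gaussianSmoothing hs (x j) (r j) w u).const_mul _
    refine (h1.exp.mul h2).congr_deriv ?_
    have h3 : ∀ j, gaussianSmoothing s (x j) (r j) ((X - C z) * w) u =
        gaussianSmoothing s (x j) (r j) (X * w) u - z * gaussianSmoothing s (x j) (r j) w u := by
      intro j
      rw [show (X - C z) * w = X * w + C (-z) * w by rw [C_neg]; ring, gaussianSmoothing_add,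
        gaussianSmoothing_C_mul]
      ring
    simp only [h3]
    simp only [Finset.mul_sum]
    rw [← Finset.sum_add_distrib]
    refine Finset.sum_congr rfl fun j _ => ?_
    field_simp
    ring

/-- A combination of Gaussian densities whose initial measure times `q` is nonnegative. -/
theorem sum_gaussianSmoothing_nonneg (J : Finset ι) (a x : ι → ℝ) (r : ι → ℝ≥0) (s : ℝ≥0)
    (q : ℝ[X]) (h0 : ∀ j ∈ J, r j = 0 → 0 ≤ a j * q.eval (x j))
    (h1 : ∀ y, 0 ≤ q.eval y * ∑ j ∈ J, a j * gaussianPDFReal (x j) (r j) y) (u : ℝ) :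
    0 ≤ ∑ j ∈ J, a j * gaussianSmoothing s (x j) (r j) q u := by
  have e : ∀ j ∈ J, a j * gaussianSmoothing s (x j) (r j) q u =
      (if r j = 0 then a j * q.eval (x j) * gaussianPDFReal (x j) s u else 0) +
        ∫ y, a j * (gaussianPDFReal (x j) (r j) y * (q.eval y * gaussianPDFReal y s u)) := by
    intro j _
    split_ifs with h
    · rw [h, gaussianSmoothing_zero_var]
      simp [mul_assoc]
    · rw [gaussianSmoothing, integral_gaussianReal_eq_integral_smul h, zero_add, integral_const_mul]
      rfl
  rw [Finset.sum_congr rfl e, Finset.sum_add_distrib]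
  refine add_nonneg (Finset.sum_nonneg fun j hj => ?_) ?_
  · split_ifs with h
    · exact mul_nonneg (h0 j hj h) (gaussianPDFReal_nonneg _ _ _)
    · rfl
  · rw [← integral_finsetSum]
    · refine integral_nonneg fun y => ?_
      have : ∑ j ∈ J, a j * (gaussianPDFReal (x j) (r j) y * (q.eval y * gaussianPDFReal y s u)) =
          (q.eval y * ∑ j ∈ J, a j * gaussianPDFReal (x j) (r j) y) * gaussianPDFReal y s u := by
        rw [Finset.mul_sum, Finset.sum_mul]
        exact Finset.sum_congr rfl fun j _ => by ring
      simp only [Pi.zero_apply, this]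
      exact mul_nonneg (h1 y) (gaussianPDFReal_nonneg _ _ _)
    · intro j _
      refine Integrable.const_mul ?_ _
      rcases eq_or_ne (r j) 0 with h | h
      · simp [h]
      have h2 := integrable_eval_mul_kernel s (x j) (r j) q u
      rw [gaussianReal_of_var_ne_zero _ h, integrable_withDensity_iff_integrable_smul'
        (measurable_gaussianPDF _ _) (by simp [gaussianPDF_lt_top])] at h2
      simpa [toReal_gaussianPDF] using h2

/-- If the initial measure times the split polynomial `q` is nonnegative, then the smoothed
function has the sign of a split polynomial of no larger degree. -/
theorem exists_polynomial_sum_gaussianPDFReal_of_nonneg (J : Finset ι) (a x : ι → ℝ) (r : ι → ℝ≥0)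
    {s : ℝ≥0} (hs : s ≠ 0) {q : ℝ[X]} (hq : q ≠ 0)
    (hsplit : Multiset.card q.roots = q.natDegree)
    (h0 : ∀ j ∈ J, r j = 0 → 0 ≤ a j * q.eval (x j))
    (h1 : ∀ y, 0 ≤ q.eval y * ∑ j ∈ J, a j * gaussianPDFReal (x j) (r j) y) :
    ∃ D : ℝ[X], D ≠ 0 ∧ Multiset.card D.roots = D.natDegree ∧ D.natDegree ≤ q.natDegree ∧
      ∀ y, 0 ≤ D.eval y * ∑ j ∈ J, a j * gaussianPDFReal (x j) (s + r j) y := by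
  have hlc : q.leadingCoeff ≠ 0 := leadingCoeff_ne_zero.2 hq
  have hfac : (q.roots.map fun z => X - C z).prod * C q.leadingCoeff = q := by
    rw [mul_comm]
    exact C_leadingCoeff_mul_prod_multiset_X_sub_C hsplit
  -- With all linear factors of `q` present the smoothed function is nonnegative, hence has no sign
  -- change; removing them one by one adds at most one change each.
  have h2 := signChangesLE_sum_gaussianSmoothing J a x r hs q.roots (C q.leadingCoeff) (k := 0)
    (by
      rw [hfac]
      exact signChangesLE_zero_of_nonneg (sum_gaussianSmoothing_nonneg J a x r s q h0 h1))
  rw [hsplit, zero_add] at h2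
  obtain ⟨D, d1, d2, d3, d4⟩ := h2.exists_polynomial
  refine ⟨C q.leadingCoeff * D, mul_ne_zero (by simpa using hlc) d1, ?_, ?_, fun y => ?_⟩
  · rw [roots_C_mul _ hlc, natDegree_C_mul hlc, d2]
  · rwa [natDegree_C_mul hlc]
  · refine (d4 y).trans_eq ?_
    rw [eval_mul, eval_C, mul_comm q.leadingCoeff, mul_assoc]
    congr 1
    rw [Finset.mul_sum]
    refine Finset.sum_congr rfl fun j _ => ?_
    rw [← mul_one (C q.leadingCoeff), gaussianSmoothing_C_mul, gaussianSmoothing_one hs]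
    ring

theorem prod_X_sub_C_sq_properties [DecidableEq ι] (A : Finset ι) (x : ι → ℝ) :
    (∏ i ∈ A, (X - C (x i)) ^ 2) ≠ (0 : ℝ[X]) ∧
      Multiset.card (∏ i ∈ A, (X - C (x i)) ^ 2).roots = 2 * A.card ∧
      (∏ i ∈ A, (X - C (x i)) ^ 2).natDegree = 2 * A.card := by
  have hne : ∀ i ∈ A, (X - C (x i)) ^ 2 ≠ (0 : ℝ[X]) := fun i _ =>
    pow_ne_zero 2 (X_sub_C_ne_zero _)
  refine ⟨Finset.prod_ne_zero_iff.2 hne, ?_, ?_⟩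
  · rw [roots_prod _ _ (Finset.prod_ne_zero_iff.2 hne)]
    simp [mul_comm]
  · rw [natDegree_prod _ _ hne]
    simp [mul_comm]

/-- A combination of `m` Gaussian densities has the sign of a split polynomial of degree at most
`2 * (m - 1)`. -/
theorem exists_polynomial_sum_gaussianPDFReal [DecidableEq ι] (J : Finset ι) (hJ : J.Nonempty)
    (a x : ι → ℝ) (v : ι → ℝ≥0) (hv : ∀ j ∈ J, v j ≠ 0) :
    ∃ D : ℝ[X], D ≠ 0 ∧ Multiset.card D.roots = D.natDegree ∧ D.natDegree ≤ 2 * (J.card - 1) ∧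
      ∀ y, 0 ≤ D.eval y * ∑ j ∈ J, a j * gaussianPDFReal (x j) (v j) y := by
  induction hn : J.card using Nat.strong_induction_on generalizing J v with
  | _ n ih =>
    -- Subtracting the least variance turns the narrowest components into point masses and leaves
    -- fewer genuine Gaussians, to which the induction applies; smoothing by `s` then restores the
    -- original variances.
    obtain ⟨i₀, hi₀, hmin⟩ := J.exists_min_image v hJ
    set s := v i₀ with hs
    set r : ι → ℝ≥0 := fun j => v j - s with hr
    set A := J.filter (fun j => r j = 0) with hA
    set B := J.filter (fun j => ¬ r j = 0) with hB
    have hcard : A.card + B.card = n := by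
      rw [hA, hB, Finset.card_filter_add_card_filter_not, hn]
    have hiA : i₀ ∈ A := by simp [hA, hr, hs, hi₀]
    have hApos : 0 < A.card := Finset.card_pos.2 ⟨i₀, hiA⟩
    -- A density of variance `0` is the zero function by convention, so the point masses drop out
    -- here and need their own sign condition.
    have hsumB : ∀ y, ∑ j ∈ J, a j * gaussianPDFReal (x j) (r j) y =
        ∑ j ∈ B, a j * gaussianPDFReal (x j) (r j) y := by
      intro y
      rw [hB, Finset.sum_filter]
      refine Finset.sum_congr rfl fun j _ => ?_
      split_ifs with h
      · rw [h]; simp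
      · rfl
    have hq : ∃ q : ℝ[X], q ≠ 0 ∧ Multiset.card q.roots = q.natDegree ∧
        q.natDegree ≤ 2 * (n - 1) ∧ (∀ j ∈ J, r j = 0 → 0 ≤ a j * q.eval (x j)) ∧
        ∀ y, 0 ≤ q.eval y * ∑ j ∈ J, a j * gaussianPDFReal (x j) (r j) y := by
      rcases B.eq_empty_or_nonempty with hBe | hBn
      -- Only point masses remain. All but one are killed by double zeros and the last is matched by
      -- a constant sign, which saves two in the degree.
      · obtain ⟨p1, p2, p3⟩ := prod_X_sub_C_sq_properties (A.erase i₀) x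
        rw [Finset.card_erase_of_mem hiA] at p2 p3
        set P := ∏ i ∈ A.erase i₀, (X - C (x i)) ^ 2 with hP
        set σ : ℝ := if 0 ≤ a i₀ then 1 else -1 with hσ
        have hσ0 : σ ≠ 0 := by rw [hσ]; split_ifs <;> norm_num
        have hσa : 0 ≤ a i₀ * σ := by
          rw [hσ]; split_ifs with h
          · simpa using h
          · linarith
        have hBcard : B.card = 0 := by simp [hBe]
        refine ⟨C σ * P, mul_ne_zero (by simpa using hσ0) p1, ?_, ?_, fun j hj hrj => ?_,
          fun y => by simp [hsumB, hBe]⟩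
        · rw [roots_C_mul _ hσ0, natDegree_C_mul hσ0, p2, p3]
        · rw [natDegree_C_mul hσ0, p3]
          lia
        · have hPn : 0 ≤ P.eval (x j) := by
            rw [hP, eval_prod]
            exact Finset.prod_nonneg fun i _ => by rw [eval_pow]; positivity
          rw [eval_mul, eval_C, ← mul_assoc]
          rcases eq_or_ne j i₀ with rfl | hne
          · exact mul_nonneg hσa hPn
          · have : P.eval (x j) = 0 := by
              rw [hP, eval_prod]
              refine Finset.prod_eq_zero (i := j) ?_ (by simp)
              simp [hA, hj, hrj, hne]
            simp [this]
      · obtain ⟨p1, p2, p3⟩ := prod_X_sub_C_sq_properties A x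
        set P := ∏ i ∈ A, (X - C (x i)) ^ 2 with hP
        obtain ⟨D, d1, d2, d3, d4⟩ := ih B.card (by lia) B hBn r
          (fun j hj => (Finset.mem_filter.1 hj).2) rfl
        have hBpos := Finset.card_pos.2 hBn
        refine ⟨D * P, mul_ne_zero d1 p1, ?_, ?_, fun j hj hrj => ?_, fun y => ?_⟩
        · rw [roots_mul (mul_ne_zero d1 p1), natDegree_mul d1 p1, Multiset.card_add, d2, p2, p3]
        · rw [natDegree_mul d1 p1, p3]
          lia
        · have : P.eval (x j) = 0 := by
            rw [hP, eval_prod]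
            exact Finset.prod_eq_zero (i := j) (by simp [hA, hj, hrj]) (by simp)
          simp [this]
        · rw [hsumB, eval_mul, mul_right_comm]
          refine mul_nonneg (d4 y) ?_
          rw [hP, eval_prod]
          exact Finset.prod_nonneg fun i _ => by rw [eval_pow]; positivity
    obtain ⟨q, q1, q2, q3, q4, q5⟩ := hq
    obtain ⟨D, d1, d2, d3, d4⟩ :=
      exists_polynomial_sum_gaussianPDFReal_of_nonneg J a x r (hv i₀ hi₀) q1 q2 q4 q5
    refine ⟨D, d1, d2, d3.trans q3, fun y => (d4 y).trans_eq ?_⟩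
    congr 1
    refine Finset.sum_congr rfl fun j hj => ?_
    rw [hr, ← hs, add_tsub_cancel_of_le (hmin j hj)]

end

/-! ### The test polynomial. -/

section

variable {ι : Type*} [Fintype ι] [DecidableEq ι]

/-- There is a nonzero multiple `D * v`, with `v` of degree at most `2 * A.card`, whose caloric
extension from time `τ` has a multiple root at each point of `A`. -/
theorem exists_polynomial_caloric_multiple_roots (D : ℝ[X]) (τ : ℝ) (A : Finset (ℝ × ℝ)) :
    ∃ v : ℝ[X], v ≠ 0 ∧ v.natDegree ≤ 2 * A.card ∧ ∀ b ∈ A,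
      (heat (b.2 - τ) (D * v)).IsRoot b.1 ∧ (derivative (heat (b.2 - τ) (D * v))).IsRoot b.1 := by
  let Φ : ℝ[X] →ₗ[ℝ] (A → ℝ × ℝ) := LinearMap.pi fun b =>
    LinearMap.prod (leval b.1.1 ∘ₗ heat (b.1.2 - τ) ∘ₗ LinearMap.mulLeft ℝ D)
      (leval b.1.1 ∘ₗ derivative ∘ₗ heat (b.1.2 - τ) ∘ₗ LinearMap.mulLeft ℝ D)
  let e := degreeLTEquiv ℝ (2 * A.card + 1)
  let Ψ : (Fin (2 * A.card + 1) → ℝ) →ₗ[ℝ] (A → ℝ × ℝ) :=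
    Φ ∘ₗ (degreeLT ℝ (2 * A.card + 1)).subtype ∘ₗ e.symm.toLinearMap
  -- There are `2 * A.card` linear conditions on a space of dimension `2 * A.card + 1`.
  have hker : LinearMap.ker Ψ ≠ ⊥ := by
    refine LinearMap.ker_ne_bot_of_finrank_lt ?_
    rw [Module.finrank_pi_fintype, Module.finrank_fintype_fun_eq_card]
    simp [mul_comm]
  obtain ⟨c, hc, hc0⟩ := (Submodule.ne_bot_iff _).1 hker
  refine ⟨(e.symm c : ℝ[X]), ?_, ?_, fun b hb => ?_⟩
  · simpa using hc0
  · have h1 := mem_degreeLT.1 (e.symm c).2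
    exact Nat.lt_succ_iff.1 ((natDegree_lt_iff_degree_lt (by simpa using hc0)).2 h1)
  · have h1 : Φ (e.symm c : ℝ[X]) = 0 := hc
    have h2 := congrFun h1 ⟨b, hb⟩
    have h3 := congrArg Prod.fst h2
    have h4 := congrArg Prod.snd h2
    exact ⟨h3, h4⟩

/-- A polynomial of degree at most `2 * (card ι - 1)` that has the sign of the combination
`∑ j, a j * N(x j, t j - τ)` over the components later than `τ`, and whose caloric extension
vanishes at the other components. -/
theorem exists_sign_matching_polynomial (a x t : ι → ℝ) (τ : ℝ) (hτ : ∃ j, τ < t j) :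
    ∃ q : ℝ[X], q ≠ 0 ∧ q.natDegree ≤ 2 * (Fintype.card ι - 1) ∧
      (∀ y, 0 ≤ q.eval y * ∑ j, a j * gaussianPDFReal (x j) (t j - τ).toNNReal y) ∧
      Integrable (fun y => q.eval y * ∑ j, a j * gaussianPDFReal (x j) (t j - τ).toNNReal y) ∧
      ∑ j, a j * (heat (t j) (heat (-τ) q)).eval (x j) =
        ∫ y, q.eval y * ∑ j, a j * gaussianPDFReal (x j) (t j - τ).toNNReal y := by
  set L := Finset.univ.filter (fun j => τ < t j) with hL
  set Z := Finset.univ.filter (fun j => t j = τ) with hZ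
  set S := Finset.univ.filter (fun j => t j < τ) with hS
  set f : ℝ → ℝ := fun y => ∑ j, a j * gaussianPDFReal (x j) (t j - τ).toNNReal y with hf
  have hcard : L.card + Z.card + S.card = Fintype.card ι := by
    rw [← Finset.card_union_of_disjoint, ← Finset.card_union_of_disjoint]
    · rw [← Finset.card_univ]
      congr 1
      ext j
      simp only [hL, hZ, hS, Finset.mem_union, Finset.mem_filter, Finset.mem_univ, true_and,
        iff_true]
      rcases lt_trichotomy τ (t j) with h | h | h
      · exact Or.inl (Or.inl h)
      · exact Or.inl (Or.inr h.symm)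
      · exact Or.inr h
    · rw [Finset.disjoint_left]
      intro j hj hj'
      simp only [hL, hZ, hS, Finset.mem_union, Finset.mem_filter, Finset.mem_univ, true_and] at hj hj'
      rcases hj with h | h <;> linarith
    · rw [Finset.disjoint_left]
      intro j hj hj'
      simp only [hL, hZ, Finset.mem_filter, Finset.mem_univ, true_and] at hj hj'
      linarith
  -- Components not later than `τ` have their variance truncated to `0`, so their density is zero
  -- and `f` involves only `L`.
  have hvar : ∀ j, ¬ τ < t j → (t j - τ).toNNReal = 0 := fun j hj =>
    Real.toNNReal_of_nonpos (by linarith)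
  have hvarL : ∀ j, τ < t j → (t j - τ).toNNReal ≠ 0 := fun j hj => by
    simpa using hj
  have hfL : ∀ y, f y = ∑ j ∈ L, a j * gaussianPDFReal (x j) (t j - τ).toNNReal y := by
    intro y
    rw [hL, Finset.sum_filter]
    refine Finset.sum_congr rfl fun j _ => ?_
    split_ifs with h
    · rfl
    · rw [hvar j h]; simp
  have hLne : L.Nonempty := by
    obtain ⟨j, hj⟩ := hτ
    exact ⟨j, by simpa [hL] using hj⟩
  have hLpos := Finset.card_pos.2 hLne
  obtain ⟨D, d1, d2, d3, d4⟩ := exists_polynomial_sum_gaussianPDFReal L hLne a x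
    (fun j => (t j - τ).toNNReal) (fun j hj => hvarL j (by simpa [hL] using hj))
  obtain ⟨p1, p2, p3⟩ := prod_X_sub_C_sq_properties Z x
  set P := ∏ i ∈ Z, (X - C (x i)) ^ 2 with hP
  set A := S.image (fun j => (x j, t j)) with hA
  have hAcard : A.card ≤ S.card := Finset.card_image_le
  have hDP : D * P ≠ 0 := mul_ne_zero d1 p1
  obtain ⟨v, v1, v2, v3⟩ := exists_polynomial_caloric_multiple_roots (D * P) τ A
  have hq0 : D * P * v ≠ 0 := mul_ne_zero hDP v1
  have hroots := card_roots_add_two_mul_card_le hq0 τ A (fun b hb => by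
    obtain ⟨j, hj, rfl⟩ := Finset.mem_image.1 hb
    simpa [hS] using hj) v3
  -- `D` and `P` have as many roots as their degrees, and `v` has degree at most `2 * A.card`; the
  -- root count leaves none for `v`.
  have hv0 : v.roots = 0 := by
    rw [roots_mul hq0, roots_mul hDP, natDegree_mul hDP v1, natDegree_mul d1 p1,
      Multiset.card_add, Multiset.card_add, d2, p2, p3] at hroots
    exact Multiset.card_eq_zero.1 (by lia)
  obtain ⟨σ, hσ, hpos⟩ := exists_sign_of_roots_eq_zero v1 hv0
  have hσ0 : σ ≠ 0 := by rcases hσ with rfl | rfl <;> norm_num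
  set q := C σ * (D * P * v) with hq
  have hPn : ∀ y, 0 ≤ P.eval y := fun y => by
    rw [hP, eval_prod]
    exact Finset.prod_nonneg fun i _ => by rw [eval_pow]; positivity
  have hint : ∀ j, Integrable (fun y =>
      q.eval y * gaussianPDFReal (x j) (t j - τ).toNNReal y) := fun j => by
    by_cases h : τ < t j
    · exact integrable_eval_mul_gaussianPDFReal q (x j) (hvarL j h)
    · simp [hvar j h]
  have e : ∀ y, q.eval y * f y =
      ∑ j, a j * (q.eval y * gaussianPDFReal (x j) (t j - τ).toNNReal y) := fun y => by
    rw [hf, Finset.mul_sum]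
    exact Finset.sum_congr rfl fun j _ => by ring
  refine ⟨q, mul_ne_zero (by simpa using hσ0) hq0, ?_, fun y => ?_, ?_, ?_⟩
  · rw [hq, natDegree_C_mul hσ0, natDegree_mul hDP v1, natDegree_mul d1 p1, p3]
    lia
  · change 0 ≤ q.eval y * f y
    rw [hfL, hq]
    have h1 := mul_nonneg (mul_nonneg (d4 y) (hPn y)) (hpos y).le
    refine h1.trans_eq ?_
    simp only [eval_mul, eval_C]
    ring
  · change Integrable fun y => q.eval y * f y
    simp only [e]
    exact integrable_finsetSum _ fun j _ => (hint j).const_mul _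
  · change _ = ∫ y, q.eval y * f y
    simp only [e]
    rw [integral_finsetSum _ fun j _ => (hint j).const_mul _]
    refine Finset.sum_congr rfl fun j _ => ?_
    rw [integral_const_mul, heat_heat, ← sub_eq_add_neg]
    congr 1
    rcases lt_trichotomy τ (t j) with h | h | h
    · rw [integral_eval_mul_gaussianPDFReal q (x j) (hvarL j h),
        Real.coe_toNNReal _ (sub_nonneg.2 h.le)]
    · rw [hvar j (by linarith), h, sub_self, heat_zero]
      have : P.eval (x j) = 0 := by
        rw [hP, eval_prod]
        exact Finset.prod_eq_zero (i := j) (by simp [hZ, h]) (by simp)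
      simp [hq, this]
    · rw [hvar j (by linarith)]
      have h1 := (v3 (x j, t j) (Finset.mem_image.2 ⟨j, by simpa [hS] using h, rfl⟩)).1
      rw [hq, ← smul_eq_C_mul, map_smul, eval_smul, h1.eq_zero]
      simp

end

/-! ### From small moment differences to an upper bound on the functional. -/

/-- The sum of the absolute values of the coefficients up to degree `N`. -/
noncomputable def coeffNorm (N : ℕ) (p : ℝ[X]) : ℝ := ∑ i ∈ Finset.range (N + 1), |p.coeff i|

theorem coeffNorm_nonneg (N : ℕ) (p : ℝ[X]) : 0 ≤ coeffNorm N p :=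
  Finset.sum_nonneg fun _ _ => abs_nonneg _

theorem coeffNorm_add_le (N : ℕ) (p q : ℝ[X]) :
    coeffNorm N (p + q) ≤ coeffNorm N p + coeffNorm N q := by
  rw [coeffNorm, coeffNorm, coeffNorm, ← Finset.sum_add_distrib]
  exact Finset.sum_le_sum fun i _ => by rw [coeff_add]; exact abs_add_le _ _

theorem coeffNorm_smul (N : ℕ) (c : ℝ) (p : ℝ[X]) :
    coeffNorm N (c • p) = |c| * coeffNorm N p := by
  simp [coeffNorm, Finset.mul_sum, abs_mul]

theorem coeffNorm_X_mul_le (N : ℕ) (p : ℝ[X]) : coeffNorm N (X * p) ≤ coeffNorm N p := by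
  rw [coeffNorm, Finset.sum_range_succ', coeffNorm, Finset.sum_range_succ]
  simp only [coeff_X_mul, coeff_X_mul_zero, abs_zero, add_zero]
  exact le_add_of_nonneg_right (abs_nonneg _)

theorem coeffNorm_derivative_le {N : ℕ} {p : ℝ[X]} (hp : p.natDegree ≤ N) :
    coeffNorm N (derivative p) ≤ N * coeffNorm N p := by
  have h0 : p.coeff (N + 1) = 0 := coeff_eq_zero_of_natDegree_lt (by lia)
  rw [coeffNorm, Finset.sum_range_succ, coeffNorm, Finset.sum_range_succ']
  simp only [coeff_derivative, h0, zero_mul, abs_zero, add_zero]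
  rw [mul_add, Finset.mul_sum]
  refine (Finset.sum_le_sum fun i hi => ?_).trans (le_add_of_nonneg_right (by positivity))
  rw [abs_mul, mul_comm]
  refine mul_le_mul_of_nonneg_right ?_ (abs_nonneg _)
  rw [abs_of_nonneg (by positivity)]
  exact_mod_cast Finset.mem_range.1 hi

/-- Under the flow a factor `d (X - y)` acts as the operator `d (X - y + s ∂)`, which multiplies the
norm by at most `|d| (1 + |y| + |s| N)`, since `∂` costs at most `N` in degrees up to `N`. -/
theorem coeffNorm_heat_prod_le {κ : Type*} [DecidableEq κ] {N : ℕ} (s : ℝ) (T : Finset κ)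
    (hT : T.card ≤ N) (d y : κ → ℝ) {B : ℝ} (hB : ∀ j ∈ T, |d j| * (1 + |y j| + |s| * N) ≤ B) :
    coeffNorm N (heat s (∏ j ∈ T, C (d j) * (X - C (y j)))) ≤ B ^ T.card ∧
      (heat s (∏ j ∈ T, C (d j) * (X - C (y j)))).natDegree ≤ T.card := by
  induction T using Finset.induction_on with
  | empty =>
    refine ⟨?_, by simp [heat_one]⟩
    simp [heat_one, coeffNorm, coeff_one, apply_ite abs]
  | insert b T hb ih =>
    rw [Finset.card_insert_of_notMem hb] at hT
    obtain ⟨h1, h2⟩ := ih (by lia) fun j hj => hB j (Finset.mem_insert_of_mem hj)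
    set p := heat s (∏ j ∈ T, C (d j) * (X - C (y j))) with hp
    have hBb := hB b (Finset.mem_insert_self _ _)
    have e : heat s (∏ j ∈ insert b T, C (d j) * (X - C (y j))) =
        d b • (X * p + ((-y b) • p + s • derivative p)) := by
      rw [Finset.prod_insert hb, mul_assoc, ← smul_eq_C_mul, map_smul, heat_X_sub_C_mul, ← hp,
        sub_mul, neg_smul, ← smul_eq_C_mul]
      congr 1
      ring
    have hpN : p.natDegree ≤ N := by lia
    rw [e, Finset.card_insert_of_notMem hb]
    constructor
    · rw [coeffNorm_smul, pow_succ']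
      have h3 : coeffNorm N (X * p + ((-y b) • p + s • derivative p)) ≤
          (1 + |y b| + |s| * N) * coeffNorm N p := by
        refine (coeffNorm_add_le _ _ _).trans ?_
        have h4 := coeffNorm_add_le N ((-y b) • p) (s • derivative p)
        rw [coeffNorm_smul, coeffNorm_smul, abs_neg] at h4
        have h5 := mul_le_mul_of_nonneg_left (coeffNorm_derivative_le hpN) (abs_nonneg s)
        linarith [coeffNorm_X_mul_le N p]
      have h6 := mul_le_mul_of_nonneg_left h3 (abs_nonneg (d b))
      rw [← mul_assoc] at h6
      refine h6.trans (mul_le_mul hBb h1 (coeffNorm_nonneg _ _) ?_)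
      exact le_trans (by positivity) hBb
    · refine (natDegree_smul_le _ _).trans ?_
      refine natDegree_add_le_of_degree_le ?_ (natDegree_add_le_of_degree_le ?_ ?_)
      · exact natDegree_mul_le.trans (by rw [natDegree_X]; lia)
      · exact (natDegree_smul_le _ _).trans (by lia)
      · exact (natDegree_smul_le _ _).trans ((natDegree_derivative_le _).trans (by lia))

theorem abs_linearMap_le_coeffNorm (Λ : ℝ[X] →ₗ[ℝ] ℝ) {N : ℕ} {η : ℝ}
    (hΛ : ∀ r ≤ N, |Λ (X ^ r)| ≤ η) {p : ℝ[X]} (hp : p.natDegree ≤ N) :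
    |Λ p| ≤ η * coeffNorm N p := by
  conv_lhs => rw [p.as_sum_range' (N + 1) (by lia), map_sum]
  refine (Finset.abs_sum_le_sum_abs _ _).trans ?_
  rw [coeffNorm, Finset.mul_sum]
  refine Finset.sum_le_sum fun i hi => ?_
  rw [← C_mul_X_pow_eq_monomial, ← smul_eq_C_mul, map_smul, smul_eq_mul, abs_mul, mul_comm]
  exact mul_le_mul_of_nonneg_right (hΛ i (by simpa [Nat.lt_succ_iff] using hi)) (abs_nonneg _)

/-- Lagrange interpolation at separated nodes bounds a functional on the heat extension. -/
theorem abs_linearMap_heat_le_sum (Λ : ℝ[X] →ₗ[ℝ] ℝ) {N : ℕ} {η : ℝ} (hη : 0 ≤ η)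
    (hΛ : ∀ r ≤ N, |Λ (X ^ r)| ≤ η) (s : ℝ) {g R : ℝ} (hg : 0 < g) (y : ℕ → ℝ)
    (hy : ∀ i ≤ N, ∀ j ≤ N, i ≠ j → g ≤ |y i - y j|) (hR : ∀ j ≤ N, 1 + |y j| + |s| * N ≤ R)
    {q : ℝ[X]} (hq : q.natDegree ≤ N) :
    |Λ (heat s q)| ≤ η * (R / g) ^ N * ∑ i ∈ Finset.range (N + 1), |q.eval (y i)| := by
  have hinj : Set.InjOn y (Finset.range (N + 1)) := by
    intro i hi j hj hij
    by_contra hne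
    simp only [Finset.coe_range, Set.mem_Iio] at hi hj
    have := hy i (by lia) j (by lia) hne
    rw [hij, sub_self, abs_zero] at this
    linarith
  have hdeg : q.degree < (Finset.range (N + 1)).card := by
    rw [Finset.card_range]
    exact degree_le_natDegree.trans_lt (by exact_mod_cast Nat.lt_succ_iff.2 hq)
  rw [Lagrange.eq_interpolate hinj hdeg, Lagrange.interpolate_apply, map_sum, map_sum,
    Finset.mul_sum, ← Lagrange.interpolate_apply, ← Lagrange.eq_interpolate hinj hdeg]
  refine (Finset.abs_sum_le_sum_abs _ _).trans (Finset.sum_le_sum fun i hi => ?_)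
  rw [← smul_eq_C_mul, map_smul, map_smul, smul_eq_mul, abs_mul, mul_comm]
  refine mul_le_mul_of_nonneg_right ?_ (abs_nonneg _)
  have hiN : i ≤ N := by simpa [Nat.lt_succ_iff] using hi
  have hcard : ((Finset.range (N + 1)).erase i).card = N := by
    rw [Finset.card_erase_of_mem hi, Finset.card_range, Nat.add_sub_cancel]
  obtain ⟨h1, h2⟩ := coeffNorm_heat_prod_le (N := N) s ((Finset.range (N + 1)).erase i) hcard.le
    (fun j => (y i - y j)⁻¹) y (B := R / g) (fun j hj => by
      obtain ⟨hji, hj'⟩ := Finset.mem_erase.1 hj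
      have hjN : j ≤ N := by simpa [Nat.lt_succ_iff] using hj'
      have h3 := hy i hiN j hjN (Ne.symm hji)
      rw [abs_inv, div_eq_inv_mul]
      have : 0 ≤ 1 + |y j| + |s| * N := by positivity
      exact mul_le_mul (inv_anti₀ hg h3) (hR j hjN) this (by positivity))
  rw [hcard] at h1 h2
  refine (abs_linearMap_le_coeffNorm Λ hΛ (p := heat s (Lagrange.basis (Finset.range (N + 1)) y i))
    ?_).trans (mul_le_mul_of_nonneg_left ?_ hη)
  · exact h2
  · exact h1

/-- If a functional, evaluated on the heat extension of `q`, is the integral of `q * f` with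
`q * f` nonnegative and `f` not small near `c`, then it is not small on some low power. -/
theorem le_of_linearMap_heat_eq_integral (Λ : ℝ[X] →ₗ[ℝ] ℝ) {N : ℕ} {η : ℝ} (hη : 0 ≤ η)
    (hΛ : ∀ r ≤ N, |Λ (X ^ r)| ≤ η) (s : ℝ) {c ρ R : ℝ} (hρ : 0 < ρ)
    (hR : 1 + (|c| + ρ) + |s| * N ≤ R) {q : ℝ[X]} (hq0 : q ≠ 0) (hq : q.natDegree ≤ N)
    {f : ℝ → ℝ} (hqf : ∀ y, 0 ≤ q.eval y * f y) (hint : Integrable fun y => q.eval y * f y)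
    (hΛq : Λ (heat s q) = ∫ y, q.eval y * f y) (hf : ∀ y, |y - c| ≤ ρ → 1 ≤ |f y|) :
    2 * ρ / (N + 1) ≤ η * (R / (2 * ρ / (N + 1))) ^ N := by
  set g := 2 * ρ / (N + 1) with hg
  have hN : (0 : ℝ) < N + 1 := by positivity
  have hg0 : 0 < g := by positivity
  have hgN : g * (N + 1) = 2 * ρ := by rw [hg]; field_simp
  set b : ℕ → ℝ := fun i => c - ρ + i * g with hb
  set I := ∫ y, q.eval y * f y with hI
  have hcont : Continuous fun y => |q.eval y| := by fun_prop
  have hbN : b (N + 1) = c + ρ := by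
    simp only [hb]
    push_cast
    linarith
  have hb0 : b 0 = c - ρ := by simp [hb]
  have hsmall : ∫ y in (c - ρ)..(c + ρ), |q.eval y| ≤ I := by
    rw [intervalIntegral.integral_of_le (by linarith)]
    calc ∫ y in Set.Ioc (c - ρ) (c + ρ), |q.eval y|
        ≤ ∫ y in Set.Ioc (c - ρ) (c + ρ), q.eval y * f y := by
          refine setIntegral_mono_on ?_ hint.integrableOn measurableSet_Ioc fun y hy => ?_
          · exact (hcont.integrableOn_Icc).mono_set Set.Ioc_subset_Icc_self
          · rw [← abs_of_nonneg (hqf y), abs_mul]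
            refine le_mul_of_one_le_right (abs_nonneg _) (hf y ?_)
            rw [abs_le]
            constructor <;> linarith [hy.1, hy.2]
      _ ≤ I := setIntegral_le_integral hint (Filter.Eventually.of_forall hqf)
  have hpos : 0 < ∫ y in (c - ρ)..(c + ρ), |q.eval y| := by
    have hlt : c - ρ < c + ρ := by linarith
    refine intervalIntegral.integral_pos hlt hcont.continuousOn (fun _ _ => abs_nonneg _) ?_
    by_contra! h
    refine hq0 (eq_zero_of_infinite_isRoot q ((Set.Icc_infinite hlt).mono fun y hy => ?_))
    exact abs_nonpos_iff.1 (h y hy)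
  -- Interpolation at a grid of `N + 1` nodes of spacing `g`, shifted by `θ`. As `θ` runs over `[0,
  -- g]` the shifted grids cover the window exactly, so integrating in `θ` turns the sums of `|q|`
  -- into its integral.
  have hpt : ∀ θ ∈ Set.Icc 0 g, I ≤ η * (R / g) ^ N *
      ∑ i ∈ Finset.range (N + 1), |q.eval (b i + θ)| := by
    intro θ hθ
    rw [← hΛq]
    refine (le_abs_self _).trans (abs_linearMap_heat_le_sum Λ hη hΛ s hg0 (fun i => b i + θ)
      (fun i _ j _ hij => ?_) (fun j hj => ?_) hq)
    · have : b i + θ - (b j + θ) = ((i : ℝ) - j) * g := by simp only [hb]; ring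
      rw [this, abs_mul, abs_of_pos hg0]
      refine le_mul_of_one_le_left hg0.le ?_
      have : (1 : ℤ) ≤ |(i : ℤ) - j| := Int.one_le_abs (by lia)
      exact_mod_cast this
    · have h1 : (j : ℝ) * g + g ≤ 2 * ρ := by
        have : (j : ℝ) + 1 ≤ N + 1 := by exact_mod_cast Nat.succ_le_succ hj
        nlinarith
      have h2 : |b j + θ| ≤ |c| + ρ := by
        have h3 : |b j + θ - c| ≤ ρ := by
          rw [abs_le]
          have : 0 ≤ (j : ℝ) * g := by positivity
          constructor <;> simp only [hb] <;> linarith [hθ.1, hθ.2]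
        have h4 := abs_sub_abs_le_abs_sub (b j + θ) c
        linarith
      linarith
  have hsum : ∑ i ∈ Finset.range (N + 1), ∫ θ in (0 : ℝ)..g, |q.eval (b i + θ)| =
      ∫ y in (c - ρ)..(c + ρ), |q.eval y| := by
    rw [← hb0, ← hbN, ← intervalIntegral.sum_integral_adjacent_intervals
      (fun k _ => hcont.intervalIntegrable _ _)]
    refine Finset.sum_congr rfl fun i _ => ?_
    rw [intervalIntegral.integral_comp_add_left (fun y => |q.eval y|) (b i)]
    congr 1
    · simp
    · simp only [hb]; push_cast; ring
  have hcont' : ∀ i, Continuous fun θ => |q.eval (b i + θ)| := fun i => by fun_prop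
  have hmain : g * I ≤ η * (R / g) ^ N * I := by
    have h1 : ∫ _ in (0 : ℝ)..g, I ≤ ∫ θ in (0 : ℝ)..g, η * (R / g) ^ N *
        ∑ i ∈ Finset.range (N + 1), |q.eval (b i + θ)| := by
      refine intervalIntegral.integral_mono_on hg0.le (by simp) ?_ hpt
      refine Continuous.intervalIntegrable ?_ _ _
      exact continuous_const.mul (continuous_finsetSum _ fun i _ => hcont' i)
    rw [intervalIntegral.integral_const, intervalIntegral.integral_const_mul,
      intervalIntegral.integral_finsetSum (fun i _ => (hcont' i).intervalIntegrable _ _), hsum,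
      sub_zero, smul_eq_mul] at h1
    refine h1.trans (mul_le_mul_of_nonneg_left hsmall ?_)
    have : 0 ≤ R := le_trans (by positivity) hR
    positivity
  -- The unknown size of `q` cancels, since `I` is positive for `q ≠ 0`.
  exact le_of_mul_le_mul_right hmain (hpos.trans_le hsmall)

/-! ### Size of the densities near a spike. -/

theorem one_div_le_gaussianPDFReal {ρ : ℝ} (hρ : 0 < ρ) {m y : ℝ} (hy : |y - m| ≤ ρ) {v : ℝ≥0}
    (hv : (v : ℝ) = ρ ^ 2) : 1 / (6 * ρ) ≤ gaussianPDFReal m v y := by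
  simp only [gaussianPDFReal_def, hv]
  have h1 : √(2 * Real.pi * ρ ^ 2) ≤ 3 * ρ := by
    rw [Real.sqrt_le_left (by positivity)]
    nlinarith [Real.pi_lt_four, sq_nonneg ρ]
  have h2 : (1 : ℝ) / 2 ≤ Real.exp (-(y - m) ^ 2 / (2 * ρ ^ 2)) := by
    have h3 := Real.add_one_le_exp (-(y - m) ^ 2 / (2 * ρ ^ 2))
    have h4 : (y - m) ^ 2 ≤ ρ ^ 2 := sq_le_sq' (by linarith [(abs_le.1 hy).1]) (abs_le.1 hy).2
    have h5 : (y - m) ^ 2 / (2 * ρ ^ 2) ≤ 1 / 2 := by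
      rw [div_le_div_iff₀ (by positivity) (by positivity)]
      linarith
    rw [neg_div] at h3 ⊢
    linarith
  have h6 : (3 * ρ)⁻¹ ≤ (√(2 * Real.pi * ρ ^ 2))⁻¹ :=
    inv_anti₀ (Real.sqrt_pos.2 (by positivity)) h1
  calc 1 / (6 * ρ) = (3 * ρ)⁻¹ * (1 / 2) := by field_simp; norm_num
    _ ≤ _ := mul_le_mul h6 h2 (by norm_num) (by positivity)

/-- A component far from `(c, t₀)` is either much later, hence flat; much earlier, hence of
truncated variance and zero; or centred far from the window, where the bound uniform in the variance
applies. -/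
theorem gaussianPDFReal_le_of_separated {δ ρ c t₀ m t y : ℝ} (hδ : 0 < δ) (hδ1 : δ ≤ 1)
    (hρ : ρ ^ 2 ≤ δ / 4) (hρ' : ρ ≤ δ / 4) (hsep : δ ≤ |m - c| + |t - t₀|) (hy : |y - c| ≤ ρ) :
    gaussianPDFReal m (t - (t₀ - ρ ^ 2)).toNNReal y ≤ 2 / δ := by
  set v := (t - (t₀ - ρ ^ 2)).toNNReal with hv
  rcases eq_or_ne v 0 with h0 | h0
  · rw [h0]
    simp
    positivity
  have hvpos : 0 < t - (t₀ - ρ ^ 2) := by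
    simpa [hv] using h0
  rcases le_or_gt (δ / 2) |t - t₀| with h | h
  · have h1 : δ / 2 ≤ t - t₀ := by
      rcases le_abs.1 h with h | h <;> linarith
    have h2 : δ / 2 ≤ (v : ℝ) := by
      rw [hv, Real.coe_toNNReal _ hvpos.le]
      nlinarith
    refine (gaussianPDFReal_le_inv_sqrt _ _ _).trans ?_
    rw [inv_le_comm₀ (Real.sqrt_pos.2 (by positivity)) (by positivity)]
    refine Real.le_sqrt_of_sq_le ?_
    rw [inv_div]
    nlinarith [Real.pi_gt_three]
  · have h1 : δ / 4 ≤ |y - m| := by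
      have := abs_sub_abs_le_abs_sub (m - c) (y - c)
      rw [show m - c - (y - c) = -(y - m) by ring, abs_neg] at this
      linarith
    have h2 := abs_sub_mul_gaussianPDFReal_le m h0 y
    have h3 := gaussianPDFReal_nonneg m v y
    rw [le_div_iff₀ hδ]
    nlinarith

theorem abs_exp_neg_sub_exp_neg_le {A B : ℝ} (hA : 0 ≤ A) (hB : 0 ≤ B) :
    |Real.exp (-A) - Real.exp (-B)| ≤ |A - B| := by
  wlog h : A ≤ B generalizing A B
  · rw [abs_sub_comm, abs_sub_comm A]
    exact this hB hA (le_of_not_ge h)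
  have h1 : Real.exp (-A) * (1 - (B - A)) ≤ Real.exp (-B) := by
    rw [show -B = -A + (-(B - A)) by ring, Real.exp_add]
    exact mul_le_mul_of_nonneg_left (by linarith [Real.add_one_le_exp (-(B - A))])
      (Real.exp_pos _).le
  have h2 : Real.exp (-A) ≤ 1 := Real.exp_le_one_iff.2 (by linarith)
  have h3 : Real.exp (-B) ≤ Real.exp (-A) := Real.exp_le_exp.2 (by linarith)
  rw [abs_of_nonneg (by linarith), abs_of_nonpos (by linarith)]
  nlinarith

/-- The change of the normalising constants contributes `δ / ρ³`, and that of the exponents `6δ /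
ρ²` times a factor `1 / ρ`. -/
theorem abs_gaussianPDFReal_sub_le {δ ρ m m' y : ℝ} {v v' : ℝ≥0} (hρ : 0 < ρ) (hρ1 : ρ ≤ 1)
    (hv : (v : ℝ) = ρ ^ 2) (hδ : δ ≤ ρ ^ 2 / 2) (hm : |m - m'| ≤ δ) (hvv : |(v : ℝ) - v'| ≤ δ)
    (hy : |y - m| ≤ ρ) :
    |gaussianPDFReal m v y - gaussianPDFReal m' v' y| ≤ 7 * δ / ρ ^ 3 := by
  have hδ0 : 0 ≤ δ := (abs_nonneg _).trans hm
  have hβ : 0 < ρ ^ 2 := by positivity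
  have hv'2 : ρ ^ 2 / 2 ≤ (v' : ℝ) := by
    have := (abs_le.1 hvv).2
    linarith
  have hv'0 : 0 < (v' : ℝ) := by linarith
  simp only [gaussianPDFReal_def]
  rw [hv] at hvv ⊢
  set S := √(2 * Real.pi * ρ ^ 2) with hS
  set S' := √(2 * Real.pi * v') with hS'
  have hpi := Real.pi_gt_three
  have hS2 : S ^ 2 = 2 * Real.pi * ρ ^ 2 := Real.sq_sqrt (by positivity)
  have hS'2 : S' ^ 2 = 2 * Real.pi * v' := Real.sq_sqrt (by positivity)
  have hSρ : ρ ≤ S := Real.le_sqrt_of_sq_le (by nlinarith)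
  have hS'ρ : ρ ≤ S' := Real.le_sqrt_of_sq_le (by nlinarith)
  have hS0 : 0 < S := hρ.trans_le hSρ
  have hS'0 : 0 < S' := hρ.trans_le hS'ρ
  have d1 : |S⁻¹ - S'⁻¹| ≤ δ / ρ ^ 3 := by
    have e1 : S⁻¹ - S'⁻¹ = (S' ^ 2 - S ^ 2) / ((S + S') * S * S') := by
      field_simp
      ring
    have e2 : |S' ^ 2 - S ^ 2| ≤ 2 * Real.pi * δ := by
      rw [hS2, hS'2, ← mul_sub, abs_mul, abs_of_pos (by positivity), abs_sub_comm]
      gcongr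
    rw [e1, abs_div, abs_of_pos (by positivity : 0 < (S + S') * S * S'),
      div_le_div_iff₀ (by positivity) (by positivity)]
    have e3 : 2 * Real.pi * ρ ^ 3 ≤ (S + S') * S * S' := by
      have : 2 * Real.pi * ρ ^ 3 = S ^ 2 * ρ := by rw [hS2]; ring
      rw [this]
      have h1 : S ^ 2 ≤ (S + S') * S := by nlinarith
      exact mul_le_mul h1 hS'ρ hρ.le (by positivity)
    calc |S' ^ 2 - S ^ 2| * ρ ^ 3 ≤ 2 * Real.pi * δ * ρ ^ 3 := by gcongr
      _ = δ * (2 * Real.pi * ρ ^ 3) := by ring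
      _ ≤ δ * ((S + S') * S * S') := by gcongr
  set A := (y - m) ^ 2 / (2 * ρ ^ 2) with hA
  set B := (y - m') ^ 2 / (2 * v') with hB
  have d2 : |A - B| ≤ 6 * δ / ρ ^ 2 := by
    have h1 : |y - m'| ≤ 2 * ρ := by
      have : |y - m'| ≤ |y - m| + |m - m'| := abs_sub_le _ _ _
      nlinarith
    have e1 : A - B = (m - m') * (-(y - m) - (y - m')) / (2 * ρ ^ 2) +
        (y - m') ^ 2 * (v' - ρ ^ 2) / (2 * ρ ^ 2 * v') := by
      rw [hA, hB]
      field_simp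
      ring
    have e2 : |(m - m') * (-(y - m) - (y - m')) / (2 * ρ ^ 2)| ≤ 2 * δ / ρ ^ 2 := by
      rw [abs_div, abs_of_pos (by positivity : 0 < 2 * ρ ^ 2), abs_mul]
      have h2 : |-(y - m) - (y - m')| ≤ 4 := by
        rw [abs_le] at h1 hy ⊢
        constructor <;> linarith
      calc |m - m'| * |-(y - m) - (y - m')| / (2 * ρ ^ 2) ≤ δ * 4 / (2 * ρ ^ 2) := by gcongr
        _ = 2 * δ / ρ ^ 2 := by field_simp; norm_num
    have e3 : |(y - m') ^ 2 * (v' - ρ ^ 2) / (2 * ρ ^ 2 * v')| ≤ 4 * δ / ρ ^ 2 := by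
      rw [abs_div, abs_of_pos (by positivity : 0 < 2 * ρ ^ 2 * v'), abs_mul, abs_pow,
        abs_sub_comm (v' : ℝ)]
      calc |y - m'| ^ 2 * |ρ ^ 2 - v'| / (2 * ρ ^ 2 * v')
          ≤ (2 * ρ) ^ 2 * δ / (2 * ρ ^ 2 * (ρ ^ 2 / 2)) := by gcongr
        _ = 4 * δ / ρ ^ 2 := by field_simp; ring
    rw [e1]
    refine (abs_add_le _ _).trans ((add_le_add e2 e3).trans_eq ?_)
    ring
  have hA0 : 0 ≤ A := by positivity
  have hB0 : 0 ≤ B := by positivity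
  rw [neg_div, neg_div, ← hA, ← hB]
  have e : S⁻¹ * Real.exp (-A) - S'⁻¹ * Real.exp (-B) =
      S⁻¹ * (Real.exp (-A) - Real.exp (-B)) + (S⁻¹ - S'⁻¹) * Real.exp (-B) := by ring
  rw [e]
  refine (abs_add_le _ _).trans ?_
  rw [abs_mul, abs_mul, abs_of_pos (inv_pos.2 hS0), abs_of_pos (Real.exp_pos _)]
  have h1 : S⁻¹ * |Real.exp (-A) - Real.exp (-B)| ≤ ρ⁻¹ * (6 * δ / ρ ^ 2) :=
    mul_le_mul (inv_anti₀ hρ hSρ) ((abs_exp_neg_sub_exp_neg_le hA0 hB0).trans d2) (abs_nonneg _)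
      (by positivity)
  have h2 : |S⁻¹ - S'⁻¹| * Real.exp (-B) ≤ δ / ρ ^ 3 * 1 :=
    mul_le_mul d1 (Real.exp_le_one_iff.2 (by linarith)) (Real.exp_pos _).le (by positivity)
  refine (add_le_add h1 h2).trans_eq ?_
  field_simp
  norm_num

theorem abs_sum_gaussianPDFReal_ge {ι : Type*} [Fintype ι] [DecidableEq ι] (a x t : ι → ℝ)
    (T : Finset ι) (ha : ∑ j, |a j| ≤ 2) {δ ρ c t₀ y : ℝ} (hδ : 0 < δ) (hδ1 : δ ≤ 1)
    (hρ : ρ ^ 2 ≤ δ / 4) (hρ' : ρ ≤ δ / 4) (hsep : ∀ j ∉ T, δ ≤ |x j - c| + |t j - t₀|)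
    (hy : |y - c| ≤ ρ) :
    |∑ j ∈ T, a j * gaussianPDFReal (x j) (t j - (t₀ - ρ ^ 2)).toNNReal y| - 4 / δ ≤
      |∑ j, a j * gaussianPDFReal (x j) (t j - (t₀ - ρ ^ 2)).toNNReal y| := by
  rw [← Finset.sum_add_sum_compl T]
  have h1 : |∑ j ∈ Tᶜ, a j * gaussianPDFReal (x j) (t j - (t₀ - ρ ^ 2)).toNNReal y| ≤ 4 / δ := by
    calc |∑ j ∈ Tᶜ, a j * gaussianPDFReal (x j) (t j - (t₀ - ρ ^ 2)).toNNReal y|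
        ≤ ∑ j ∈ Tᶜ, |a j * gaussianPDFReal (x j) (t j - (t₀ - ρ ^ 2)).toNNReal y| :=
          Finset.abs_sum_le_sum_abs _ _
      _ ≤ ∑ j ∈ Tᶜ, |a j| * (2 / δ) := by
          refine Finset.sum_le_sum fun j hj => ?_
          rw [abs_mul, abs_of_nonneg (gaussianPDFReal_nonneg _ _ _)]
          exact mul_le_mul_of_nonneg_left (gaussianPDFReal_le_of_separated hδ hδ1 hρ hρ'
            (hsep j (Finset.mem_compl.1 hj)) hy) (abs_nonneg _)
      _ ≤ ∑ j, |a j| * (2 / δ) :=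
          Finset.sum_le_sum_of_subset_of_nonneg (Finset.subset_univ _)
            fun _ _ _ => by positivity
      _ ≤ 2 * (2 / δ) := by
          rw [← Finset.sum_mul]
          gcongr
      _ = 4 / δ := by ring
  have h2 := abs_sub_abs_le_abs_sub
    (∑ j ∈ T, a j * gaussianPDFReal (x j) (t j - (t₀ - ρ ^ 2)).toNNReal y)
    (-∑ j ∈ Tᶜ, a j * gaussianPDFReal (x j) (t j - (t₀ - ρ ^ 2)).toNNReal y)
  rw [abs_neg, sub_neg_eq_add] at h2
  linarith

/-! ### Application to mixtures. -/

namespace GaussianMixture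

variable {n k : ℕ}

theorem moment_eq (F : GaussianMixture n) (r : ℕ) :
    F.moment r = ∑ i, F.weight i * (heat (F.var i) (X ^ r)).eval (F.mean i) := by
  have hv : ∀ i, F.var i ≠ 0 := fun i => (F.var_pos i).ne'
  have e : ∀ y, y ^ r * F.pdf y = ∑ i, F.weight i *
      ((X ^ r : ℝ[X]).eval y * gaussianPDFReal (F.mean i) (F.var i) y) := fun y => by
    rw [pdf, Finset.mul_sum]
    refine Finset.sum_congr rfl fun i _ => ?_
    rw [eval_pow, eval_X]
    ring
  simp only [moment, e]
  rw [integral_finsetSum _ fun i _ =>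
    (integrable_eval_mul_gaussianPDFReal _ _ (hv i)).const_mul _]
  refine Finset.sum_congr rfl fun i _ => ?_
  rw [integral_const_mul, integral_eval_mul_gaussianPDFReal _ _ (hv i)]

/-- The weights of `F` and the negated weights of `F'`. -/
def signedWeight (F : GaussianMixture n) (F' : GaussianMixture k) : Fin n ⊕ Fin k → ℝ :=
  Sum.elim F.weight fun j => -F'.weight j

/-- The means of `F` and `F'`. -/
def jointMean (F : GaussianMixture n) (F' : GaussianMixture k) : Fin n ⊕ Fin k → ℝ :=
  Sum.elim F.mean F'.mean

/-- The variances of `F` and `F'`. -/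
def jointVar (F : GaussianMixture n) (F' : GaussianMixture k) : Fin n ⊕ Fin k → ℝ :=
  Sum.elim (fun i => (F.var i : ℝ)) fun j => (F'.var j : ℝ)

/-- The difference of the expectations of a polynomial under `F` and `F'`. -/
noncomputable def expectationDiff (F : GaussianMixture n) (F' : GaussianMixture k) :
    ℝ[X] →ₗ[ℝ] ℝ :=
  ∑ j, signedWeight F F' j • (leval (jointMean F F' j) ∘ₗ heat (jointVar F F' j))

theorem expectationDiff_apply (F : GaussianMixture n) (F' : GaussianMixture k) (p : ℝ[X]) :
    expectationDiff F F' p =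
      ∑ j, signedWeight F F' j * (heat (jointVar F F' j) p).eval (jointMean F F' j) := by
  simp [expectationDiff]

theorem expectationDiff_X_pow (F : GaussianMixture n) (F' : GaussianMixture k) (r : ℕ) :
    expectationDiff F F' (X ^ r) = F.moment r - F'.moment r := by
  rw [expectationDiff_apply, moment_eq, moment_eq, Fintype.sum_sum_type]
  simp [signedWeight, jointMean, jointVar, sub_eq_add_neg]

theorem moment_zero (F : GaussianMixture n) : F.moment 0 = 1 := by
  simp [moment_eq, heat_one, F.sum_weight]

theorem pos_of_weights (F : GaussianMixture n) : 0 < n := by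
  rcases Nat.eq_zero_or_pos n with rfl | h
  · simpa using F.sum_weight
  · exact h

theorem card_mul_le_one {F : GaussianMixture n} {ε : ℝ} (h : ∀ i, ε ≤ F.weight i) :
    n * ε ≤ 1 := by
  rw [← F.sum_weight]
  simpa using Finset.sum_le_sum fun i (_ : i ∈ Finset.univ) => h i

theorem sum_abs_signedWeight (F : GaussianMixture n) (F' : GaussianMixture k) :
    ∑ j, |signedWeight F F' j| = 2 := by
  rw [Fintype.sum_sum_type]
  simp only [signedWeight, Sum.elim_inl, Sum.elim_inr, abs_neg, abs_of_nonneg (F.weight_nonneg _),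
    abs_of_nonneg (F'.weight_nonneg _), F.sum_weight, F'.sum_weight]
  norm_num

theorem exists_moment_diff_ge {F : GaussianMixture n} {F' : GaussianMixture k} {ε : ℝ}
    (hε : 0 < ε) (hε1 : ε < 1 / 1000) (h : F.IsStandard F' ε) {t₀ c ρ : ℝ} (ht₀ : 0 ≤ t₀)
    (ht₀1 : t₀ ≤ 1) (hc : |c| ≤ 1 / ε) (hρ : ε ^ 13 ≤ ρ) (hρ1 : ρ ≤ 1)
    (hlate : ∃ j, t₀ - ρ ^ 2 < jointVar F F' j)
    (hlow : ∀ y, |y - c| ≤ ρ → 1 ≤ |∑ j, signedWeight F F' j *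
      gaussianPDFReal (jointMean F F' j) (jointVar F F' j - (t₀ - ρ ^ 2)).toNNReal y|) :
    ∃ r ∈ Finset.Icc 1 (2 * (n + k - 1)), ε ^ (100 * max n k) ≤ |F.moment r - F'.moment r| := by
  by_contra! hcon
  have hn := F.pos_of_weights
  have hk := F'.pos_of_weights
  have hnε := card_mul_le_one fun i => (h.weight_mem i).1
  have hkε := card_mul_le_one fun i => (h.weight_mem' i).1
  have hρ0 : 0 < ρ := lt_of_lt_of_le (by positivity) hρ
  set N := 2 * (n + k - 1) with hN
  have hNcast : (N : ℝ) + 1 = 2 * (n + k) - 1 := by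
    have : N + 2 = 2 * (n + k) := by lia
    have : (N : ℝ) + 2 = 2 * (n + k) := by exact_mod_cast this
    linarith
  obtain ⟨q, q1, q2, q3, q4, q5⟩ := exists_sign_matching_polynomial (signedWeight F F')
    (jointMean F F') (jointVar F F') (t₀ - ρ ^ 2) hlate
  rw [← expectationDiff_apply] at q5
  have hcard : Fintype.card (Fin n ⊕ Fin k) = n + k := by simp
  rw [hcard, ← hN] at q2
  set η := ε ^ (100 * max n k) with hη
  have hη0 : 0 < η := by positivity
  have hs : |-(t₀ - ρ ^ 2)| ≤ 1 := by
    rw [abs_neg, abs_le]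
    constructor <;> nlinarith
  -- Weights at least `ε` force `n, k ≤ 1/ε`, so factors of size `N` cost only powers of `ε`.
  have hNε : (N + 1) * ε ≤ 4 := by
    rw [hNcast]
    nlinarith
  have key := le_of_linearMap_heat_eq_integral (expectationDiff F F') hη0.le
    (fun r hr => by
      rw [expectationDiff_X_pow]
      rcases Nat.eq_zero_or_pos r with rfl | hr0
      · simpa [moment_zero] using hη0.le
      · exact (hcon r (Finset.mem_Icc.2 ⟨hr0, hr⟩)).le)
    (-(t₀ - ρ ^ 2)) (R := 1 / ε ^ 2) hρ0 (by
      have h1 : |-(t₀ - ρ ^ 2)| * N ≤ 4 / ε := by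
        rw [le_div_iff₀ hε]
        have : |-(t₀ - ρ ^ 2)| * N ≤ 1 * N := by gcongr
        nlinarith
      have h2 : 2 + 5 / ε ≤ 1 / ε ^ 2 := by
        rw [le_div_iff₀ (by positivity)]
        have : (2 + 5 / ε) * ε ^ 2 = 2 * ε ^ 2 + 5 * ε := by field_simp
        nlinarith
      have h3 : 4 / ε + 1 / ε = 5 / ε := by ring
      linarith) q1 q2 q3 q4 q5 hlow
  set g := 2 * ρ / (N + 1) with hg
  have hg15 : ε ^ 15 ≤ g := by
    rw [hg, le_div_iff₀ (by positivity)]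
    have h1 : ε ^ 15 * (N + 1) ≤ ε ^ 14 * 4 := by
      calc ε ^ 15 * ((N : ℝ) + 1) = ε ^ 14 * ((N + 1) * ε) := by ring
        _ ≤ ε ^ 14 * 4 := by gcongr
    have h2 : ε ^ 14 * 4 ≤ ε ^ 13 * 1 := by
      rw [pow_succ _ 13, mul_assoc]
      gcongr
      linarith
    linarith
  have hRg : 1 / ε ^ 2 / g ≤ 1 / ε ^ 17 := by
    rw [div_div]
    refine one_div_le_one_div_of_le (by positivity) ?_
    calc ε ^ 17 = ε ^ 2 * ε ^ 15 := by ring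
      _ ≤ ε ^ 2 * g := by gcongr
  have hg0 : 0 < g := lt_of_lt_of_le (by positivity) hg15
  have h1 : ε ^ 15 ≤ η * (1 / ε ^ 17) ^ N := by
    refine hg15.trans (key.trans ?_)
    gcongr
  rw [one_div, inv_pow, ← div_eq_mul_inv, le_div_iff₀ (by positivity), ← pow_mul, ← pow_add,
    hη] at h1
  -- At this point `ε ^ (15 + 17 N) ≤ ε ^ (100 max n k)`, whereas `N ≤ 4 max n k - 2` makes the left
  -- exponent smaller.
  refine absurd h1 (not_le.2 (pow_lt_pow_right_of_lt_one₀ hε (by linarith) ?_))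
  have : n ≤ max n k := le_max_left _ _
  have : k ≤ max n k := le_max_right _ _
  lia

theorem paramDist_le_of_pair (F : GaussianMixture n) (F' : GaussianMixture k) (i : Fin n)
    (j j' : Fin k) : F'.paramDist F' j j' ≤ F.paramDist F' i j + F.paramDist F' i j' := by
  have h1 := abs_sub_le (F'.mean j) (F.mean i) (F'.mean j')
  have h2 := abs_sub_le (F'.var j : ℝ) (F.var i) (F'.var j')
  rw [abs_sub_comm (F'.mean j) (F.mean i)] at h1
  rw [abs_sub_comm (F'.var j : ℝ) (F.var i)] at h2
  simp only [paramDist]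
  linarith

theorem paramDist_inl (F : GaussianMixture n) (F' : GaussianMixture k) (i i' : Fin n) :
    |jointMean F F' (Sum.inl i') - F.mean i| + |jointVar F F' (Sum.inl i') - F.var i| =
      F.paramDist F i' i := rfl

theorem paramDist_inr (F : GaussianMixture n) (F' : GaussianMixture k) (i : Fin n) (j : Fin k) :
    |jointMean F F' (Sum.inr j) - F.mean i| + |jointVar F F' (Sum.inr j) - F.var i| =
      F.paramDist F' i j := by
  simp only [jointMean, jointVar, Sum.elim_inr, paramDist]
  rw [abs_sub_comm, abs_sub_comm (F'.var j : ℝ)]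

theorem exists_moment_diff_ge_of_unmatched {F : GaussianMixture n} {F' : GaussianMixture k}
    {ε : ℝ} (hε : 0 < ε) (hε1 : ε < 1 / 1000) (h : F.IsStandard F' ε) (i : Fin n)
    (hi : ∀ j, ε ^ 11 ≤ F.paramDist F' i j) :
    ∃ r ∈ Finset.Icc 1 (2 * (n + k - 1)), ε ^ (100 * max n k) ≤ |F.moment r - F'.moment r| := by
  have hle : ε ≤ 1 := by linarith
  have hρ : 0 < ε ^ 13 := by positivity
  have h13 : ε ^ 13 ≤ ε ^ 11 / 4 := by
    have : ε ^ 13 = ε ^ 11 * ε ^ 2 := by ring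
    rw [this, div_eq_mul_inv]
    gcongr
    nlinarith
  have h13' : ε ^ 13 ≤ 1 := pow_le_one₀ hε.le hle
  have hsq : (ε ^ 13) ^ 2 ≤ ε ^ 13 := by nlinarith
  refine exists_moment_diff_ge hε hε1 h (t₀ := F.var i) (c := F.mean i) (ρ := ε ^ 13)
    (by positivity) (by exact_mod_cast h.var_le i) (h.mean_le i) le_rfl h13'
    ⟨Sum.inl i, by simp only [jointVar, Sum.elim_inl]; linarith [pow_pos hρ 2]⟩ fun y hy => ?_
  have h1 := abs_sum_gaussianPDFReal_ge (signedWeight F F') (jointMean F F') (jointVar F F')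
    {Sum.inl i} (sum_abs_signedWeight F F').le (δ := ε ^ 11) (by positivity)
    (pow_le_one₀ hε.le hle) (hsq.trans h13) h13 (c := F.mean i) (t₀ := F.var i) (fun j hj => by
      rcases j with i' | j
      · have hne : i' ≠ i := fun h => hj (by simp [h])
        rw [paramDist_inl]
        exact (pow_le_of_le_one hε.le hle (by norm_num)).trans (h.separated i' i hne)
      · rw [paramDist_inr]
        exact hi j) hy
  refine le_trans ?_ h1
  rw [Finset.sum_singleton, abs_mul, abs_of_nonneg (gaussianPDFReal_nonneg _ _ _)]
  have hw : ε ≤ |signedWeight F F' (Sum.inl i)| := (h.weight_mem i).1.trans (le_abs_self _)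
  have hp := one_div_le_gaussianPDFReal hρ hy
    (v := (jointVar F F' (Sum.inl i) - ((F.var i : ℝ) - (ε ^ 13) ^ 2)).toNNReal) (by
      rw [Real.coe_toNNReal] <;> simp only [jointVar, Sum.elim_inl] <;> ring_nf
      positivity)
  have h2 := mul_le_mul hw hp (by positivity) (abs_nonneg _)
  -- The spike has height at least of order `ε / ρ = ε⁻¹²`, against `4 / ε ^ 11` from all other
  -- components.
  have h3 : 1 + 4 / ε ^ 11 ≤ ε * (1 / (6 * ε ^ 13)) := by
    have e1 : ε * (1 / (6 * ε ^ 13)) = (1 / (6 * ε)) / ε ^ 11 := by field_simp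
    rw [e1, le_div_iff₀ (by positivity), add_mul, div_mul_cancel₀ _ (by positivity),
      le_div_iff₀ (by positivity)]
    have : ε ^ 11 ≤ 1 := pow_le_one₀ hε.le hle
    nlinarith
  have h4 : gaussianPDFReal (jointMean F F' (Sum.inl i))
      (jointVar F F' (Sum.inl i) - ((F.var i : ℝ) - (ε ^ 13) ^ 2)).toNNReal y =
      gaussianPDFReal (F.mean i)
      (jointVar F F' (Sum.inl i) - ((F.var i : ℝ) - (ε ^ 13) ^ 2)).toNNReal y := rfl
  rw [h4]
  linarith

theorem exists_moment_diff_ge_of_matched {F : GaussianMixture n} {F' : GaussianMixture k}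
    {ε : ℝ} (hε : 0 < ε) (hε1 : ε < 1 / 1000) (h : F.IsStandard F' ε) (i : Fin n) (j : Fin k)
    (hij : F.paramDist F' i j < ε ^ 11) (hw : ε ^ 2 / 2 ≤ |F.weight i - F'.weight j|) :
    ∃ r ∈ Finset.Icc 1 (2 * (n + k - 1)), ε ^ (100 * max n k) ≤ |F.moment r - F'.moment r| := by
  have hle : ε ≤ 1 := by linarith
  have hρ : 0 < ε ^ 4 := by positivity
  have h4 : ε ^ 4 ≤ ε / 2 / 4 := by
    have h1 : ε ^ 4 ≤ ε ^ 2 := pow_le_pow_of_le_one hε.le hle (by norm_num)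
    nlinarith
  have h4' : ε ^ 4 ≤ 1 := pow_le_one₀ hε.le hle
  have hsq : (ε ^ 4) ^ 2 ≤ ε ^ 4 := by nlinarith
  have h11 : ε ^ 11 ≤ ε / 2 := by
    have h1 : ε ^ 11 ≤ ε ^ 2 := pow_le_pow_of_le_one hε.le hle (by norm_num)
    nlinarith
  refine exists_moment_diff_ge hε hε1 h (t₀ := F.var i) (c := F.mean i) (ρ := ε ^ 4)
    (by positivity) (by exact_mod_cast h.var_le i) (h.mean_le i)
    (pow_le_pow_of_le_one hε.le hle (by norm_num)) h4'
    ⟨Sum.inl i, by simp only [jointVar, Sum.elim_inl]; linarith [pow_pos hρ 2]⟩ fun y hy => ?_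
  have h1 := abs_sum_gaussianPDFReal_ge (signedWeight F F') (jointMean F F') (jointVar F F')
    {Sum.inl i, Sum.inr j} (sum_abs_signedWeight F F').le (δ := ε / 2) (by positivity)
    (by linarith) (hsq.trans h4) h4 (c := F.mean i) (t₀ := F.var i) (fun l hl => by
      rcases l with i' | j'
      · have hne : i' ≠ i := fun h => hl (by simp [h])
        rw [paramDist_inl]
        linarith [h.separated i' i hne]
      -- Since component `j` of `F'` nearly coincides with `i`, every other component of `F'` stays
      -- at distance at least `ε - ε ^ 11` from `i`.
      · have hne : j ≠ j' := fun h => hl (by simp [h])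
        rw [paramDist_inr]
        linarith [h.separated' j j' hne, paramDist_le_of_pair F F' i j j']) hy
  refine le_trans ?_ h1
  rw [Finset.sum_pair (by simp)]
  simp only [signedWeight, jointMean, jointVar, Sum.elim_inl, Sum.elim_inr]
  set v := ((F.var i : ℝ) - ((F.var i : ℝ) - (ε ^ 4) ^ 2)).toNNReal with hv
  set v' := ((F'.var j : ℝ) - ((F.var i : ℝ) - (ε ^ 4) ^ 2)).toNNReal with hv'
  have hvval : (v : ℝ) = (ε ^ 4) ^ 2 := by
    rw [hv, Real.coe_toNNReal] <;> ring_nf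
    positivity
  have hm : |F.mean i - F'.mean j| ≤ ε ^ 11 := by
    have := abs_nonneg ((F.var i : ℝ) - F'.var j)
    simp only [paramDist] at hij
    linarith
  have hvd : |(F.var i : ℝ) - F'.var j| ≤ ε ^ 11 := by
    have := abs_nonneg (F.mean i - F'.mean j)
    simp only [paramDist] at hij
    linarith
  have h118 : ε ^ 11 ≤ (ε ^ 4) ^ 2 / 2 := by
    have : ε ^ 11 = (ε ^ 4) ^ 2 * ε ^ 3 := by ring
    rw [this, div_eq_mul_inv]
    gcongr
    have : ε ^ 3 ≤ ε := pow_le_of_le_one hε.le hle (by norm_num)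
    linarith
  have hv'val : (v' : ℝ) = (F'.var j : ℝ) - ((F.var i : ℝ) - (ε ^ 4) ^ 2) := by
    rw [hv', Real.coe_toNNReal]
    linarith [(abs_le.1 hvd).2, pow_pos hρ 2]
  have hp := one_div_le_gaussianPDFReal hρ hy hvval
  have hd := abs_gaussianPDFReal_sub_le hρ h4' hvval h118 hm (v' := v') (by
    rw [hvval, hv'val]
    convert hvd using 2
    ring) hy
  set G := gaussianPDFReal (F.mean i) v y
  set G' := gaussianPDFReal (F'.mean j) v' y
  have hw' := h.weight_mem' j
  -- The two spikes nearly cancel: the weight gap leaves order `ε² / ρ = ε⁻²`, while their mismatch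
  -- and the remaining components cost only order `ε⁻¹`.
  have e1 : F.weight i * G + -F'.weight j * G' =
      (F.weight i - F'.weight j) * G - -(F'.weight j * (G - G')) := by ring
  have h2 := abs_sub_abs_le_abs_sub ((F.weight i - F'.weight j) * G) (-(F'.weight j * (G - G')))
  rw [← e1, abs_neg, abs_mul, abs_mul, abs_of_nonneg (F'.weight_nonneg j)] at h2
  have h3 : ε ^ 2 / 2 * (1 / (6 * ε ^ 4)) ≤ |F.weight i - F'.weight j| * |G| :=
    mul_le_mul hw (hp.trans (le_abs_self _)) (by positivity) (abs_nonneg _)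
  have h5 : F'.weight j * |G - G'| ≤ 1 * (7 * ε ^ 11 / (ε ^ 4) ^ 3) :=
    mul_le_mul hw'.2 hd (abs_nonneg _) (by norm_num)
  have e2 : ε ^ 2 / 2 * (1 / (6 * ε ^ 4)) = (1 / (12 * ε)) / ε := by field_simp; norm_num
  have e3 : 1 * (7 * ε ^ 11 / (ε ^ 4) ^ 3) = 7 / ε := by field_simp
  have e4 : 4 / (ε / 2) = 8 / ε := by field_simp; norm_num
  have h6 : 1 + 7 / ε + 8 / ε ≤ (1 / (12 * ε)) / ε := by
    rw [le_div_iff₀ hε, add_mul, add_mul, div_mul_cancel₀ _ hε.ne', div_mul_cancel₀ _ hε.ne',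
      le_div_iff₀ (by positivity)]
    nlinarith
  rw [e2] at h3
  rw [e3] at h5
  rw [e4]
  linarith

end GaussianMixture

theorem mainTheorem2 :
    ∃ c : ℝ, 0 < c ∧ ∃ C : ℕ,
      ∀ (n k : ℕ) (F : GaussianMixture n) (F' : GaussianMixture k) (ε : ℝ),
        0 < ε → ε < c → F.IsStandard F' ε →
          ∃ r ∈ Finset.Icc 1 (2 * (n + k - 1)),
            ε ^ (C * max n k) ≤ |F.moment r - F'.moment r| := by
  refine ⟨1 / 1000, by norm_num, 100, fun n k F F' ε hε hε1 h => ?_⟩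
  by_cases hun : ∃ i, ∀ j, ε ^ 11 ≤ F.paramDist F' i j
  · obtain ⟨i, hi⟩ := hun
    exact GaussianMixture.exists_moment_diff_ge_of_unmatched hε hε1 h i hi
  · push Not at hun
    choose π hπ using hun
    have hle : ε ≤ 1 := by linarith
    -- Otherwise every summand in `far` for `π` is below `ε²`, and since `n ε ≤ 1` the sum is below
    -- `ε`.
    obtain ⟨i, hi⟩ : ∃ i, ε ^ 2 / 2 ≤ |F.weight i - F'.weight (π i)| := by
      by_contra! hcon
      have h1 := h.far π
      have hn : 0 < n := F.pos_of_weights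
      have h11 : ε ^ 11 ≤ ε ^ 2 / 2 := by
        have h3 : ε ^ 11 ≤ ε ^ 3 := pow_le_pow_of_le_one hε.le hle (by norm_num)
        nlinarith [sq_nonneg ε]
      have h2 : ∑ i, (|F.weight i - F'.weight (π i)| + F.paramDist F' i (π i)) <
          ∑ _i : Fin n, ε ^ 2 := by
        refine Finset.sum_lt_sum_of_nonempty ⟨⟨0, hn⟩, Finset.mem_univ _⟩ fun i _ => ?_
        linarith [hcon i, hπ i]
      have h3 := GaussianMixture.card_mul_le_one fun i => (h.weight_mem i).1
      simp only [Finset.sum_const, Finset.card_univ, Fintype.card_fin, nsmul_eq_mul] at h2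
      nlinarith
    exact GaussianMixture.exists_moment_diff_ge_of_matched hε hε1 h i (π i) (hπ i) hi
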